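/- Let $\mathrm{PSL}(2,\mathbb Z)$ act on the upper half plane $\mathbb H$ by Möbius transformations, and let $\mathcal M=\mathrm{PSL}(2,\mathbb Z)\backslash\mathbb H$ be the modular orbifold. Write $S=\pm\begin{pmatrix}0&-1\\1&0\end{pmatrix}$ and $L=\pm\begin{pmatrix}1&-1\\1&0\end{pmatrix}$; they fix $i$ and $\rho=e^{\pi i/3}$ respectively. Let $a$ be the arc of the unit circle from $i$ to $\rho$, let $\mathcal F=\mathrm{PSL}(2,\mathbb Z)\cdot a\subset\mathbb H$ be the Farey tree, and let the modular arc $\circ\!\!-\!\!\bullet$ be the image of $a$ in $\mathcal M$. Let $z_0$ be the interior point of $a$ with real part $1/4$, and use its image in $\mathcal M$ as base point. Pointed covers. $\mathrm{Cov}^*(\mathcal M)$ is the category of connected orbifold covers $p:X\to\mathcal M$ with a base point $x_0$ over the base point of $\mathcal M$. An arrow from $X$ to $Y$ is a base point preserving covering map $Y\to X$ over $\mathcal M$, so that $\mathcal M$ is initial and $\mathbb H$ is final. $\mathrm{FCov}^*(\mathcal M)$ is the full subcategory of finite covers. The fundamental group of $(X,x_0)$ is the group of all $\gamma\in\mathrm{PSL}(2,\mathbb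 Z)$ with $q\circ\gamma=q$, where $q:(\mathbb H,z_0)\to(X,x_0)$ is the universal cover over $\mathcal M$. Modular graphs. A modular graph (a cover of the modular arc in the orbifold sense) is a connected graph obtained by gluing copies of the modular arc at their endpoints such that endpoints of different types never meet, $\circ$-vertices have degree 1 or 2, $\bullet$-vertices have degree 1 or 3, and the edges at each vertex of degree 3 carry a cyclic order. $\mathrm{Cov}^*(\circ\!\!-\!\!\bullet)$ is the category of modular graphs with a base edge; an arrow from $G$ to $H$ is an orbifold covering map $H\to G$, that is, a map of graphs preserving vertex types, cyclic orders and the base edge and surjective on the set of edges at each vertex. $\mathrm{FCov}^*(\circ\!\!-\!\!\bullet)$ is the full subcategory of finite graphs. The fundamental group of a pointed modular graph is the subgroup of $\mathrm{PSL}(2,\mathbb Z)$ of all words read along closed walks from the base edge to itself, where one writes $S$ on passing a $\circ$-vertex and $L$ (resp. $L^2$) on continuing with the left (resp. right) edge at a $\bullet$-vertex; walking to a terminal vertex and back reads $S$ for type $\circ$, and $L$ or $L^2$ for type $\bullet$. $\mathrm{Sub}$ (resp. $\mathrm{FSub}$) is the category of all (resp. all finite-index) subgroups of $\mathrm{PSL}(2,\mathbb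 Z)$ with inclusions as morphisms. Theorem. The projection $\mathbb H\to\mathcal M$ is an orbifold cover, the continuous maps $\mathbb H\to\mathbb H$ over $\mathcal M$ are exactly the elements of $\mathrm{PSL}(2,\mathbb Z)$, and every pointed cover $(X,x_0)$ of $\mathcal M$ receives a unique continuous map $(\mathbb H,z_0)\to(X,x_0)$ over $\mathcal M$. Moreover: (1) There is a $\mathrm{PSL}(2,\mathbb Z)$-equivariant strong deformation retraction of $\mathbb H$ onto $\mathcal F$. It descends, naturally in $X$, to a strong deformation retraction of every pointed cover $X$ of $\mathcal M$ onto the preimage $p^{-1}(\circ\!\!-\!\!\bullet)$ of the modular arc. (2) There is a functor $D:\mathrm{Cov}^*(\mathcal M)\to\mathrm{Cov}^*(\circ\!\!-\!\!\bullet)$ taking $X$ to the pointed modular graph $p^{-1}(\circ\!\!-\!\!\bullet)$: the geometric realization of $D(X)$ is homeomorphic to $p^{-1}(\circ\!\!-\!\!\bullet)$ over the modular arc, compatibly with base points and cyclic orders and naturally in $X$. Moreover $D(X)$ and $X$ have the same fundamental group in $\mathrm{PSL}(2,\mathbb Z)$. The functor $D$ restricts to an equivalence of categories $\mathrm{FCov}^*(\mathcal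 M)\simeq\mathrm{FCov}^*(\circ\!\!-\!\!\bullet)$. (3) The fundamental group is a contravariant functor on each of these categories, and gives arrow-reversing equivalences of $\mathrm{FCov}^*(\mathcal M)$ and of $\mathrm{FCov}^*(\circ\!\!-\!\!\bullet)$ with $\mathrm{FSub}$. (4) The same holds without finiteness: $D$ is an equivalence $\mathrm{Cov}^*(\mathcal M)\simeq\mathrm{Cov}^*(\circ\!\!-\!\!\bullet)$, and the fundamental group functors are arrow-reversing equivalences of both categories with $\mathrm{Sub}$. -/

import Mathlib

open CategoryTheory
open scoped UpperHalfPlane MatrixGroups unitInterval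

noncomputable section

namespace ModularOrbifold

/-! ## The modular group and its action on the upper half plane -/

/-- The modular group `PSL(2, ℤ)`. -/
abbrev Modular : Type := PSL(2, ℤ)

theorem center_le_ker :
    Subgroup.center SL(2, ℤ) ≤ (MulAction.toPermHom SL(2, ℤ) ℍ).ker := by
  intro A hA
  obtain ⟨r, hr, h⟩ := Matrix.SpecialLinearGroup.mem_center_iff.1 hA
  have hr' : r = 1 ∨ r = -1 := by
    rw [Fintype.card_fin] at hr
    simpa using hr
  rw [MonoidHom.mem_ker]
  ext1 z
  rcases hr' with rfl | rfl
  · have : A = 1 := by ext1 i j; rw [← h]; simp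
    simp [this]
  · have : A = -1 := by ext1 i j; rw [← h]; fin_cases i <;> fin_cases j <;> simp
    simp only [MulAction.toPermHom_apply, MulAction.toPerm_apply, this, Equiv.Perm.coe_one, id_eq]
    rw [ModularGroup.SL_neg_smul, one_smul]

/-- The action of `PSL(2, ℤ)` on `ℍ` by Möbius transformations. -/
instance : MulAction Modular ℍ :=
  MulAction.compHom ℍ
    (QuotientGroup.lift (Subgroup.center SL(2, ℤ)) (MulAction.toPermHom SL(2, ℤ) ℍ) center_le_ker)

theorem mk_smul (g : SL(2, ℤ)) (z : ℍ) : (QuotientGroup.mk g : Modular) • z = g • z := rfl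

/-- The class of `!![0, -1; 1, 0]`. -/
def S : Modular := QuotientGroup.mk ModularGroup.S

/-- The matrix `!![1, -1; 1, 0]`. -/
def matrixL : SL(2, ℤ) := ⟨!![1, -1; 1, 0], by simp⟩

/-- The class of `!![1, -1; 1, 0]`. -/
def L : Modular := QuotientGroup.mk matrixL

theorem S_mul_S : S * S = 1 := by
  refine (QuotientGroup.eq_one_iff (ModularGroup.S * ModularGroup.S)).2 ?_
  refine Matrix.SpecialLinearGroup.mem_center_iff.2 ⟨-1, by simp, ?_⟩
  ext i j
  fin_cases i <;> fin_cases j <;> decide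

theorem L_mul_L_sq : L * L ^ 2 = 1 := by
  refine (QuotientGroup.eq_one_iff (matrixL * matrixL ^ 2)).2 ?_
  refine Matrix.SpecialLinearGroup.mem_center_iff.2 ⟨-1, by simp, ?_⟩
  ext i j
  fin_cases i <;> fin_cases j <;> decide

/-! ## The modular orbifold, the modular arc and the Farey tree -/

/-- The underlying space of the modular orbifold `PSL(2, ℤ) \ ℍ`, with the quotient topology. Its
orbifold structure is carried by the quotient map `toOrb` and the stabilizers. -/
abbrev Orb : Type := MulAction.orbitRel.Quotient Modular ℍ

/-- The projection `ℍ → PSL(2, ℤ) \ ℍ`. -/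
def toOrb (z : ℍ) : Orb := Quotient.mk _ z

/-- The geodesic arc on the unit circle from the fixed point `i` of `S` (parameter `0`) to the
fixed point `exp (π i / 3)` of `L` (parameter `1`); it lies on the boundary of the standard
fundamental domain. -/
def arc (t : I) : ℍ :=
  ⟨⟨t / 2, Real.sqrt (1 - (t / 2 : ℝ) ^ 2)⟩, Real.sqrt_pos.2 (by
    have h0 := t.2.1
    have h1 := t.2.2
    nlinarith)⟩

/-- The image of the arc in the modular orbifold. -/
def modularArc : Set Orb := Set.range fun t : I => toOrb (arc t)

/-- The Farey tree: the `PSL(2, ℤ)`-orbit of the arc. -/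
def fareyTree : Set ℍ := {z | ∃ (γ : Modular) (t : I), z = γ • arc t}

/-- The midpoint of the parameter interval. -/
def half : I := ⟨1 / 2, by norm_num, by norm_num⟩

/-- The base point of `ℍ`, an interior point of the arc (it has trivial stabilizer). -/
def basePt : ℍ := arc half

/-! ## Orbifold covers -/

/-- `p : X → PSL(2, ℤ) \ ℍ` is an orbifold covering (in Thurston's sense): every point of the
modular orbifold, represented by `z : ℍ`, has an orbifold chart `U → U / Stab z` such that the
preimage of `U / Stab z` is a disjoint union of open sets `V i`, each of which is identified, over
`U / Stab z`, with `U / K i` for a subgroup `K i` of `Stab z`. The identification `U / K i ≃ V i` is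
given by the continuous open map `φ i : U → X` with image `V i`, whose fibres are the `K i`-orbits.
For a point `z` with trivial stabilizer this says that its image is evenly covered. -/
structure IsOrbifoldCover {X : Type} [TopologicalSpace X] (p : X → Orb) : Prop where
  continuous : Continuous p
  chart : ∀ z : ℍ, ∃ U : Set ℍ, IsOpen U ∧ z ∈ U ∧
    (∀ γ ∈ MulAction.stabilizer Modular z, ∀ u ∈ U, γ • u ∈ U) ∧
    (∀ γ : Modular, ∀ u ∈ U, γ • u ∈ U → γ ∈ MulAction.stabilizer Modular z) ∧
    ∃ (ι : Type) (V : ι → Set X) (K : ι → Subgroup Modular) (φ : ι → U → X),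
      (∀ i, IsOpen (V i)) ∧ Pairwise (fun i j => Disjoint (V i) (V j)) ∧
      (⋃ i, V i) = p ⁻¹' (toOrb '' U) ∧
      ∀ i, K i ≤ MulAction.stabilizer Modular z ∧
        Continuous (φ i) ∧ IsOpenMap (φ i) ∧ Set.range (φ i) = V i ∧
        (∀ u, p (φ i u) = toOrb u) ∧
        (∀ u u' : U, φ i u = φ i u' ↔ ∃ k ∈ K i, k • (u : ℍ) = u')

/-- A pointed connected cover of the modular orbifold: the base point lies over the image of
`basePt`. -/
structure PointedCover where
  carrier : Type
  [top : TopologicalSpace carrier]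
  [conn : ConnectedSpace carrier]
  proj : carrier → Orb
  isCover : IsOrbifoldCover proj
  base : carrier
  proj_base : proj base = toOrb basePt

attribute [instance] PointedCover.top PointedCover.conn

namespace PointedCover

/-- A covering map `X → Y` of pointed covers: a continuous base point preserving map over the
modular orbifold. (Such a map is automatically an orbifold covering.) -/
@[ext]
structure CoveringMap (X Y : PointedCover) where
  toFun : X.carrier → Y.carrier
  continuous_toFun : Continuous toFun
  proj_comp : ∀ x, Y.proj (toFun x) = X.proj x
  map_base : toFun X.base = Y.base

/-- The category `Cov*(M)`. An arrow from `X` to `Y` is a covering `Y → X`, so that the modular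
orbifold itself is initial and its universal cover is final. -/
instance : Category PointedCover where
  Hom X Y := CoveringMap Y X
  id X := ⟨id, continuous_id, fun _ => rfl, rfl⟩
  comp f g :=
    { toFun := f.toFun ∘ g.toFun
      continuous_toFun := f.continuous_toFun.comp g.continuous_toFun
      proj_comp := fun x => (f.proj_comp _).trans (g.proj_comp x)
      map_base := (congrArg f.toFun g.map_base).trans f.map_base }

/-- The covering map `Y → X` underlying an arrow from `X` to `Y`. -/
def covering {X Y : PointedCover} (f : X ⟶ Y) : Y.carrier → X.carrier := CoveringMap.toFun f

/-- Finite covers: those with finite fibres. -/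
def IsFinite : ObjectProperty PointedCover := fun X => ∀ m : Orb, (X.proj ⁻¹' {m}).Finite

/-- The graph on `X`: the preimage of the modular arc. -/
def spine (X : PointedCover) : Set X.carrier := X.proj ⁻¹' modularArc

/-- A continuous map `ℍ → X` lifting the projection of `ℍ` to the modular orbifold. -/
def IsLift (X : PointedCover) (q : ℍ → X.carrier) : Prop :=
  Continuous q ∧ ∀ z, X.proj (q z) = toOrb z

/-- The orbifold fundamental group of the pointed cover `X`, as a subgroup of `PSL(2, ℤ)`, the
fundamental group of the modular orbifold: the group of deck transformations of the pointed
universal cover `(ℍ, basePt) → (X, base)`. -/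
def fundamentalGroup (X : PointedCover) : Subgroup Modular where
  carrier := {γ | ∀ q : ℍ → X.carrier, X.IsLift q → q basePt = X.base → ∀ z, q (γ • z) = q z}
  one_mem' := by intro q _ _ z; rw [one_smul]
  mul_mem' := by
    intro a b ha hb q h1 h2 z
    rw [mul_smul, ha q h1 h2, hb q h1 h2]
  inv_mem' := by
    intro a ha q h1 h2 z
    rw [← ha q h1 h2 (a⁻¹ • z), smul_inv_smul]

end PointedCover

/-- The category `FCov*(M)` of pointed finite covers of the modular orbifold. -/
abbrev FinitePointedCover : Type 1 := PointedCover.IsFinite.FullSubcategory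

/-! ## Modular graphs -/

/-- A modular graph, that is, a (connected) cover of the modular arc in the orbifold sense: copies
of the arc, indexed by `Edge`, are glued at their endpoints, the endpoints of the two types being
glued separately, so that `∘`-vertices have degree 1 or 2, `•`-vertices have degree 1 or 3, and the
edges at each `•`-vertex are cyclically ordered. The cyclic orders are encoded by the permutation
`next`, which takes an edge to its successor at its `•`-vertex; "successor" is the edge to the
left for someone who arrives at the vertex along the given edge. -/
structure ModularGraph where
  White : Type
  Black : Type
  Edge : Type
  white : Edge → White
  black : Edge → Black
  white_degree : ∀ v, (white ⁻¹' {v}).ncard = 1 ∨ (white ⁻¹' {v}).ncard = 2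
  black_degree : ∀ v, (black ⁻¹' {v}).ncard = 1 ∨ (black ⁻¹' {v}).ncard = 3
  next : Equiv.Perm Edge
  next_cyclic : ∀ e e', black e = black e' ↔ next.SameCycle e e'
  connected : ∀ e e',
    Relation.ReflTransGen (fun a b => white a = white b ∨ black a = black b) e e'

namespace ModularGraph

/-- Two points of the disjoint union of the edges are glued if they are equal, or are the
`∘`-endpoints (parameter `0`) of two edges with the same `∘`-vertex, or are the `•`-endpoints
(parameter `1`) of two edges with the same `•`-vertex. -/
def gluing (G : ModularGraph) : Setoid (Σ _ : G.Edge, I) where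
  r a b := a = b ∨ (a.2 = 0 ∧ b.2 = 0 ∧ G.white a.1 = G.white b.1) ∨
    (a.2 = 1 ∧ b.2 = 1 ∧ G.black a.1 = G.black b.1)
  iseqv :=
    { refl := fun _ => Or.inl rfl
      symm := by
        rintro a b (h | ⟨h1, h2, h3⟩ | ⟨h1, h2, h3⟩)
        · exact Or.inl h.symm
        · exact Or.inr (Or.inl ⟨h2, h1, h3.symm⟩)
        · exact Or.inr (Or.inr ⟨h2, h1, h3.symm⟩)
      trans := by
        rintro a b c (rfl | ⟨h1, h2, h3⟩ | ⟨h1, h2, h3⟩) (rfl | ⟨k1, k2, k3⟩ | ⟨k1, k2, k3⟩)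
        · exact Or.inl rfl
        · exact Or.inr (Or.inl ⟨k1, k2, k3⟩)
        · exact Or.inr (Or.inr ⟨k1, k2, k3⟩)
        · exact Or.inr (Or.inl ⟨h1, h2, h3⟩)
        · exact Or.inr (Or.inl ⟨h1, k2, h3.trans k3⟩)
        · exact absurd (h2.symm.trans k1) zero_ne_one
        · exact Or.inr (Or.inr ⟨h1, h2, h3⟩)
        · exact absurd (k1.symm.trans h2) zero_ne_one
        · exact Or.inr (Or.inr ⟨h1, k2, h3.trans k3⟩) }

/-- The geometric realization of a modular graph, with the quotient topology. -/
def Realization (G : ModularGraph) : Type := Quotient G.gluing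

instance (G : ModularGraph) : TopologicalSpace G.Realization :=
  inferInstanceAs (TopologicalSpace (Quotient G.gluing))

/-- The point with parameter `t` on the edge `e`. -/
def point (G : ModularGraph) (e : G.Edge) (t : I) : G.Realization := Quotient.mk G.gluing ⟨e, t⟩

/-- `e'` is reached from `e` through the `∘`-vertex of `e`: it is the other edge there, or `e`
itself if that vertex is terminal. -/
def Across (G : ModularGraph) (e e' : G.Edge) : Prop :=
  G.white e = G.white e' ∧ (e = e' → ∀ d, G.white d = G.white e → d = e)

/-- `G.Walk e W e'`: there is a walk on the graph from the edge `e` to the edge `e'` which reads the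
word `W`, where one writes `S` when passing a `∘`-vertex, and `L` (resp. `L²`) when continuing
with the left (resp. right) edge at a `•`-vertex. A terminal vertex is an orbifold point; walking
to it and back reads the corresponding generator. -/
inductive Walk (G : ModularGraph) (e : G.Edge) : Modular → G.Edge → Prop
  | nil : Walk G e 1 e
  | across {W : Modular} {a b : G.Edge} : Walk G e W a → G.Across a b → Walk G e (W * S) b
  | left {W : Modular} {a : G.Edge} : Walk G e W a → Walk G e (W * L) (G.next a)
  | right {W : Modular} {a : G.Edge} : Walk G e W a → Walk G e (W * L ^ 2) (G.next.symm a)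

theorem Across.symm {G : ModularGraph} {a b : G.Edge} (h : G.Across a b) : G.Across b a := by
  refine ⟨h.1.symm, ?_⟩
  rintro rfl
  exact h.2 rfl

theorem Walk.trans {G : ModularGraph} {a b c : G.Edge} {W W' : Modular}
    (h : G.Walk a W b) (h' : G.Walk b W' c) : G.Walk a (W * W') c := by
  induction h' with
  | nil => simpa using h
  | across _ hx ih => rw [← mul_assoc]; exact ih.across hx
  | left _ ih => rw [← mul_assoc]; exact ih.left
  | right _ ih => rw [← mul_assoc]; exact ih.right

theorem Walk.symm {G : ModularGraph} {a b : G.Edge} {W : Modular}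
    (h : G.Walk a W b) : G.Walk b W⁻¹ a := by
  induction h with
  | nil => simpa using Walk.nil
  | across _ hx ih =>
    have h1 := (Walk.nil.across hx.symm).trans ih
    rwa [one_mul, eq_inv_of_mul_eq_one_left S_mul_S, ← mul_inv_rev] at h1
  | @left W c _ ih =>
    have h1 := Walk.right (Walk.nil (G := G) (e := G.next c))
    rw [Equiv.symm_apply_apply, one_mul] at h1
    have h2 := h1.trans ih
    rwa [eq_inv_of_mul_eq_one_right L_mul_L_sq, ← mul_inv_rev] at h2
  | @right W c _ ih =>
    have h1 := Walk.left (Walk.nil (G := G) (e := G.next.symm c))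
    rw [Equiv.apply_symm_apply, one_mul] at h1
    have h2 := h1.trans ih
    rwa [eq_inv_of_mul_eq_one_left L_mul_L_sq, ← mul_inv_rev] at h2

end ModularGraph

/-- A pointed modular graph: a modular graph with a base edge. -/
structure PointedModularGraph extends ModularGraph where
  base : Edge

namespace PointedModularGraph

/-- A covering map `G → H` of pointed modular graphs (in the orbifold sense): a map of graphs which
preserves the vertex types, the cyclic orders and the base edge, and is surjective on the links of
vertices. (At a `•`-vertex the last property follows from the preservation of cyclic orders.) -/
@[ext]
structure CoveringMap (G H : PointedModularGraph) where
  onWhite : G.White → H.White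
  onBlack : G.Black → H.Black
  onEdge : G.Edge → H.Edge
  white_comm : ∀ e, H.white (onEdge e) = onWhite (G.white e)
  black_comm : ∀ e, H.black (onEdge e) = onBlack (G.black e)
  next_comm : ∀ e, onEdge (G.next e) = H.next (onEdge e)
  white_surj : ∀ e d, H.white d = H.white (onEdge e) → ∃ e', G.white e' = G.white e ∧ onEdge e' = d
  map_base : onEdge G.base = H.base

/-- The category `Cov*(∘—•)`. An arrow from `G` to `H` is a covering `H → G`. -/
instance : Category PointedModularGraph where
  Hom G H := CoveringMap H G
  id G := ⟨id, id, id, fun _ => rfl, fun _ => rfl, fun _ => rfl, fun _ d h => ⟨d, h, rfl⟩, rfl⟩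
  comp f g :=
    { onWhite := f.onWhite ∘ g.onWhite
      onBlack := f.onBlack ∘ g.onBlack
      onEdge := f.onEdge ∘ g.onEdge
      white_comm := fun e => (f.white_comm _).trans (congrArg f.onWhite (g.white_comm e))
      black_comm := fun e => (f.black_comm _).trans (congrArg f.onBlack (g.black_comm e))
      next_comm := fun e => (congrArg f.onEdge (g.next_comm e)).trans (f.next_comm _)
      white_surj := fun e d h => by
        obtain ⟨d', h1, h2⟩ := f.white_surj _ d h
        obtain ⟨e', h3, h4⟩ := g.white_surj e d' h1
        exact ⟨e', h3, (congrArg f.onEdge h4).trans h2⟩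
      map_base := (congrArg f.onEdge g.map_base).trans f.map_base }

/-- The map on edges of the covering map `H → G` underlying an arrow from `G` to `H`. -/
def coveringEdge {G H : PointedModularGraph} (f : G ⟶ H) : H.Edge → G.Edge := CoveringMap.onEdge f

/-- Finite modular graphs. -/
def IsFinite : ObjectProperty PointedModularGraph := fun G => Finite G.Edge

/-- The orbifold fundamental group of a pointed modular graph: the words in `PSL(2, ℤ)` read along
the closed walks based at the base edge. -/
def fundamentalGroup (G : PointedModularGraph) : Subgroup Modular where
  carrier := {W | G.Walk G.base W G.base}
  one_mem' := ModularGraph.Walk.nil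
  mul_mem' := ModularGraph.Walk.trans
  inv_mem' := ModularGraph.Walk.symm

end PointedModularGraph

/-- The category `FCov*(∘—•)` of pointed finite modular graphs. -/
abbrev FinitePointedModularGraph : Type 1 := PointedModularGraph.IsFinite.FullSubcategory

/-! ## Subgroups -/

/-- The category `Sub(PSL(2, ℤ))` of subgroups and inclusions. -/
abbrev Sub : Type := Subgroup Modular

/-- The subgroups of finite index. -/
def HasFiniteIndex : ObjectProperty Sub := fun H => H.FiniteIndex

/-- The category `FSub(PSL(2, ℤ))` of finite index subgroups and inclusions. -/
abbrev FSub : Type := HasFiniteIndex.FullSubcategory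

/-! ## Deformation retraction -/

/-- `H` is a strong deformation retraction of `X` onto the subspace `A`. -/
structure IsDeformationRetraction {X : Type} [TopologicalSpace X] (H : I × X → X) (A : Set X) :
    Prop where
  continuous : Continuous H
  start : ∀ x, H (0, x) = x
  finish : ∀ x, H (1, x) ∈ A
  fixed : ∀ t, ∀ x ∈ A, H (t, x) = x

/-- An identification of the pointed modular graph `G` with the graph `X.spine` on the pointed cover
`X`: a homeomorphism over the modular arc which takes the midpoint of the base edge to the base
point and respects the cyclic orders at the `•`-vertices. As to the latter, if a lift `q : ℍ → X`
takes the arc to the edge `e`, then it takes the arc `L • arc`, which is the left neighbour of the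
arc at the common endpoint `exp (π i / 3)`, to the edge `next e`. -/
structure SpineIso (G : PointedModularGraph) (X : PointedCover) where
  homeo : G.Realization ≃ₜ X.spine
  proj_homeo : ∀ e t, X.proj (homeo (G.point e t)) = toOrb (arc t)
  homeo_base : (homeo (G.point G.base half) : X.carrier) = X.base
  homeo_next : ∀ q : ℍ → X.carrier, X.IsLift q → ∀ e,
    (∀ t, q (arc t) = homeo (G.point e t)) → ∀ t, q (L • arc t) = homeo (G.point (G.next e) t)

end ModularOrbifold

end

noncomputable section

namespace ModularOrbifold

/-! ## The action on the upper half plane -/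

/-! Both kinds of objects are classified by subgroups of `PSL(2, ℤ)`. A pointed cover is a quotient
`Γ \ ℍ`, and a pointed modular graph is a transitive action on its edges, hence a coset space. Since
arrows preserve base points, both categories are thin: an arrow exists exactly when the groups are
included, and every subgroup occurs. So both fundamental group functors are equivalences, and the
functor `D`, which sends a cover to the coset graph of its group, preserves groups and is therefore
an equivalence too. Finite covers and finite graphs both correspond to finite index.

For covers, the work lies in building the universal map `ℍ → X` without path lifting. The points
with nontrivial stabilizer are countable in number, and a convex open set stays connected without
them. Over the remaining points an orbifold cover is an ordinary one, so two lifts which agree at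
one free point agree everywhere (`IsLiftOn.eqOn`). This uniqueness makes local lifts glue over
overlapping convex sets, first to rectangles and then to all of `ℍ` (`hasLifts_univ`). The resulting
map is open and onto, and its fibres are the orbits of its deck group (`IsLiftOn.eq_iff`);
conversely, every quotient of `ℍ` is an orbifold cover (`isOrbifoldCover_of_quotient`).

For graphs, ping-pong shows that the modular group is the free product of the groups of order 2 and
3 generated by `S` and `L` (`ofFreeProduct_injective`). Hence crossing `∘`-vertices and turning at
`•`-vertices define an action, transitive because the graph is connected, and the words of closed
walks form the stabilizer of the base edge (`walk_iff`).

The geometric link is the standard fundamental domain. Pushing it vertically onto the unit circle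
respects its side pairings, so the push extends equivariantly to `ℍ` and descends to every cover.
The possible coincidences between translates of the arc (`eq_of_smul_arc_eq`) are exactly the
gluings of the coset graph, and local finiteness of the tiling makes the bijection from its
realization to the spine a homeomorphism (`isClosedMap_realize`). -/

theorem induction_modular {P : Modular → Prop} (h : ∀ g : SL(2, ℤ), P (QuotientGroup.mk g))
    (γ : Modular) : P γ :=
  QuotientGroup.induction_on γ h

instance : IsIsometricSMul Modular ℍ :=
  ⟨induction_modular fun g => isometry_smul ℍ (g : SL(2, ℝ))⟩

instance : Countable Modular := by
  have : Countable (Matrix (Fin 2) (Fin 2) ℤ) := inferInstanceAs (Countable (Fin 2 → Fin 2 → ℤ))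
  have : Countable SL(2, ℤ) := Subtype.countable
  exact Quotient.countable

theorem mk_neg (g : SL(2, ℤ)) : (QuotientGroup.mk (-g) : Modular) = QuotientGroup.mk g := by
  refine QuotientGroup.eq.2 (Matrix.SpecialLinearGroup.mem_center_iff.2 ⟨-1, by simp, ?_⟩)
  have : (-g)⁻¹ * g = -1 := by
    rw [← neg_one_mul g, mul_inv_rev]
    ext i j
    fin_cases i <;> fin_cases j <;> simp
  rw [this]
  ext i j
  fin_cases i <;> fin_cases j <;> simp

/-- Proper discontinuity is available for the image of `SL(2, ℤ)` in `SL(2, ℝ)`. The finite set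
found there is pulled back along the injection and pushed down to the quotient. -/
instance : ProperlyDiscontinuousSMul Modular ℍ where
  finite_disjoint_inter_image {K M} hK hM := by
    let f : SL(2, ℤ) →* SL(2, ℝ) := Matrix.SpecialLinearGroup.map (Int.castRingHom ℝ)
    have h := ProperlyDiscontinuousSMul.finite_disjoint_inter_image (Γ := f.range) hK hM
    have hf : Function.Injective f.rangeRestrict := fun a b hab => by
      have h1 : f a = f b := congrArg Subtype.val hab
      ext i j
      have h2 : (f a) i j = (f b) i j := by rw [h1]
      simpa [f] using h2
    refine ((h.preimage hf.injOn).image QuotientGroup.mk).subset fun γ => ?_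
    induction γ using induction_modular with
    | h g => exact fun hg => ⟨g, hg, rfl⟩

theorem coe_mk_smul (g : SL(2, ℤ)) (z : ℍ) : (((QuotientGroup.mk g : Modular) • z : ℍ) : ℂ) =
    ((g 0 0 : ℂ) * z + g 0 1) / ((g 1 0 : ℂ) * z + g 1 1) := by
  rw [mk_smul, UpperHalfPlane.coe_specialLinearGroup_apply]
  simp

/-- Both points satisfy `c z² + (d - a) z - b = 0`. Subtracting gives `c (z + w) = a - d`, whose
imaginary part forces `c = 0`; then `a = d` and `b = 0`, so the matrix is scalar. -/
theorem eq_one_of_smul_eq {γ : Modular} {z w : ℍ} (hzw : z ≠ w) (hz : γ • z = z)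
    (hw : γ • w = w) : γ = 1 := by
  induction γ using induction_modular with | h g => ?_
  have key : ∀ z : ℍ, (QuotientGroup.mk g : Modular) • z = z →
      (g 0 0 : ℂ) * z + g 0 1 = z * ((g 1 0 : ℂ) * z + g 1 1) := by
    intro z hz
    have h1 := coe_mk_smul g z
    have h2 : (g 1 0 : ℂ) * z + g 1 1 ≠ 0 := by
      intro h0
      rw [h0, div_zero] at h1
      exact UpperHalfPlane.ne_zero _ h1
    rw [hz, eq_div_iff h2] at h1
    exact h1.symm
  have hz' := key z hz
  have hw' := key w hw
  have hsub : (z : ℂ) - w ≠ 0 := sub_ne_zero.2 fun h => hzw (UpperHalfPlane.ext h)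
  have h1 : (g 1 0 : ℂ) * (z + w) = g 0 0 - g 1 1 := by
    apply mul_left_cancel₀ hsub
    linear_combination hw' - hz'
  have hc : g 1 0 = 0 := by
    have h2 := congrArg Complex.im h1
    simp only [Complex.mul_im, Complex.intCast_re, Complex.intCast_im, Complex.add_im,
      Complex.sub_im, UpperHalfPlane.coe_im, zero_mul, add_zero, sub_zero] at h2
    have h3 := z.im_pos
    have h4 := w.im_pos
    have : (z.im + w.im) ≠ 0 := by positivity
    exact_mod_cast (mul_eq_zero.1 h2).resolve_right this
  have had : g 0 0 = g 1 1 := by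
    rw [hc, Int.cast_zero, zero_mul, eq_comm, sub_eq_zero] at h1
    exact_mod_cast h1
  have hb : g 0 1 = 0 := by
    rw [hc, had] at hz'
    have : (g 0 1 : ℂ) = 0 := by linear_combination hz'
    exact_mod_cast this
  refine (QuotientGroup.eq_one_iff g).2
    (Matrix.SpecialLinearGroup.mem_center_iff.2 ⟨g 0 0, ?_, ?_⟩)
  · have := g.det_coe
    rw [Matrix.det_fin_two, hc, ← had] at this
    simp only [Fintype.card_fin]
    linarith
  · ext i j
    rw [Matrix.scalar_apply, Matrix.diagonal_apply]
    fin_cases i <;> fin_cases j <;> simp [hb, hc, had]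

/-- The points of `ℍ` with trivial stabilizer. -/
def free : Set ℍ := {z | ∀ γ : Modular, γ • z = z → γ = 1}

/-- The group is countable and each nontrivial element fixes at most one point. -/
theorem countable_compl_free : (freeᶜ).Countable := by
  have : (freeᶜ : Set ℍ) ⊆ ⋃ γ : {γ : Modular // γ ≠ 1}, {z | (γ : Modular) • z = z} := by
    intro z hz
    simp only [free, Set.mem_compl_iff, Set.mem_ofPred_eq, not_forall] at hz
    obtain ⟨γ, h1, h2⟩ := hz
    exact Set.mem_iUnion.2 ⟨⟨γ, h2⟩, h1⟩
  refine (Set.countable_iUnion fun γ => Set.Subsingleton.countable ?_).mono this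
  intro z hz w hw
  by_contra h
  exact γ.2 (eq_one_of_smul_eq h hz hw)

theorem toOrb_eq_iff {z w : ℍ} : toOrb z = toOrb w ↔ ∃ γ : Modular, γ • w = z := by
  rw [toOrb, toOrb, Quotient.eq, MulAction.orbitRel_apply, MulAction.mem_orbit_iff]

@[simp] theorem toOrb_smul (γ : Modular) (z : ℍ) : toOrb (γ • z) = toOrb z :=
  toOrb_eq_iff.2 ⟨γ, rfl⟩

theorem continuous_toOrb : Continuous toOrb := continuous_quotient_mk'

theorem surjective_toOrb : Function.Surjective toOrb := Quotient.mk_surjective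

theorem exists_ball_stabilizer (z : ℍ) : ∃ r > 0, ∀ γ : Modular, ∀ u ∈ Metric.ball z r,
    γ • u ∈ Metric.ball z r → γ • z = z := by
  obtain ⟨U, hU, h⟩ := ProperlyDiscontinuousSMul.exists_nhds_image_smul_eq_self Modular z
  obtain ⟨r, hr, hr'⟩ := Metric.mem_nhds_iff.1 hU
  exact ⟨r, hr, fun γ u hu hγ => h γ ⟨γ • u, ⟨u, hr' hu, rfl⟩, hr' hγ⟩⟩

theorem smul_mem_ball {γ : Modular} {z u : ℍ} {r : ℝ} (hγ : γ • z = z)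
    (hu : u ∈ Metric.ball z r) : γ • u ∈ Metric.ball z r := by
  rw [Metric.mem_ball] at *
  rwa [← hγ, dist_smul]

/-! ## The fundamental domain and the arc -/

/-- The class of `!![1, 1; 0, 1]`. -/
def T : Modular := QuotientGroup.mk ModularGroup.T

theorem L_eq : L = T * S := by
  change (QuotientGroup.mk matrixL : Modular) = QuotientGroup.mk (ModularGroup.T * ModularGroup.S)
  congr 1
  ext i j
  fin_cases i <;> fin_cases j <;> decide

theorem L_sq_eq : L ^ 2 = S * T⁻¹ := by
  change (QuotientGroup.mk (matrixL ^ 2) : Modular) =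
    QuotientGroup.mk (ModularGroup.S * ModularGroup.T⁻¹)
  congr 1
  ext i j
  fin_cases i <;> fin_cases j <;> decide

theorem S_smul_re {z : ℍ} (hz : ‖(z : ℂ)‖ = 1) : (S • z).re = -z.re := by
  rw [S, mk_smul, UpperHalfPlane.modular_S_smul, UpperHalfPlane.mk_re, Complex.inv_re,
    Complex.normSq_eq_norm_sq, norm_neg, hz]
  simp

theorem S_smul_im {z : ℍ} (hz : ‖(z : ℂ)‖ = 1) : (S • z).im = z.im := by
  rw [S, mk_smul, UpperHalfPlane.modular_S_smul, UpperHalfPlane.mk_im, Complex.inv_im,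
    Complex.normSq_eq_norm_sq, norm_neg, hz]
  simp

theorem S_smul_norm {z : ℍ} (hz : ‖(z : ℂ)‖ = 1) : ‖((S • z : ℍ) : ℂ)‖ = 1 := by
  rw [S, mk_smul, UpperHalfPlane.modular_S_smul]
  simp [hz]

theorem T_smul_re (z : ℍ) : (T • z).re = z.re + 1 := ModularGroup.re_T_smul z

theorem T_smul_im (z : ℍ) : (T • z).im = z.im := ModularGroup.im_T_smul z

theorem T_inv_smul_re (z : ℍ) : (T⁻¹ • z).re = z.re - 1 := ModularGroup.re_T_inv_smul z

theorem T_inv_smul_im (z : ℍ) : (T⁻¹ • z).im = z.im := ModularGroup.im_T_inv_smul z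

/-- The list of side pairings of the fundamental domain, with the sign of the matrix lost in the
quotient. At the left corner `γ` is not recorded: the arc lies in `re ≥ 0`, so only the right corner
matters later. -/
theorem fd_cases' {γ : Modular} {z : ℍ} (hz : z ∈ ModularGroup.fd)
    (hγ : γ • z ∈ ModularGroup.fd) :
    γ = 1 ∨ (γ = T ∧ z.re = -1 / 2) ∨ (γ = T⁻¹ ∧ z.re = 1 / 2) ∨ (γ = S ∧ ‖(z : ℂ)‖ = 1) ∨
      (‖(z : ℂ)‖ = 1 ∧ z.re = 1 / 2 ∧ (γ = L ∨ γ = L ^ 2 ∨ γ = T⁻¹ * S * T⁻¹)) ∨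
      (‖(z : ℂ)‖ = 1 ∧ z.re = -1 / 2) := by
  induction γ using induction_modular with | h g => ?_
  have key : ∀ h : SL(2, ℤ), g = h ∨ g = -h →
      (QuotientGroup.mk g : Modular) = QuotientGroup.mk h := by
    rintro h (rfl | rfl)
    · rfl
    · exact mk_neg h
  have hρ : UpperHalfPlane.ρ.re = -1 / 2 := rfl
  have hρ1 : ((1 : ℝ) +ᵥ UpperHalfPlane.ρ).re = 1 / 2 := by
    rw [UpperHalfPlane.vadd_re, hρ]; norm_num
  have hn1 : ‖(((1 : ℝ) +ᵥ UpperHalfPlane.ρ : ℍ) : ℂ)‖ = 1 := by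
    norm_num [UpperHalfPlane.ρ, Complex.norm_def, Complex.normSq, ← pow_two, div_pow]
  rcases ModularGroup.cases_of_mem_fd_smul_mem_fd hz hγ with
    h | ⟨h, hr⟩ | ⟨h, hr⟩ | ⟨h, hr⟩ | ⟨h, rfl⟩ | ⟨h, rfl⟩ | ⟨h, rfl⟩ | ⟨h, rfl⟩ | ⟨h, rfl⟩ |
      ⟨h, rfl⟩
  · exact Or.inl (key _ h)
  · exact Or.inr (Or.inl ⟨key _ h, hr⟩)
  · exact Or.inr (Or.inr (Or.inl ⟨key _ h, hr⟩))
  · exact Or.inr (Or.inr (Or.inr (Or.inl ⟨key _ h, hr⟩)))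
  · exact Or.inr (Or.inr (Or.inr (Or.inr (Or.inl ⟨hn1, hρ1, Or.inl ((key _ h).trans L_eq.symm)⟩))))
  · exact Or.inr (Or.inr (Or.inr (Or.inr (Or.inl ⟨hn1, hρ1, Or.inr (Or.inr (key _ h))⟩))))
  · exact Or.inr (Or.inr (Or.inr (Or.inr (Or.inl
      ⟨hn1, hρ1, Or.inr (Or.inl ((key _ h).trans L_sq_eq.symm))⟩))))
  all_goals exact Or.inr (Or.inr (Or.inr (Or.inr (Or.inr ⟨UpperHalfPlane.norm_ρ, hρ⟩))))

/-- Applying the list both to `γ` at `z` and to `γ⁻¹` at `γ • z` leaves only what the vertical push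
has to respect: translations between the vertical sides, and pairs of points on the unit circle. -/
theorem fd_cases {γ : Modular} {z : ℍ} (hz : z ∈ ModularGroup.fd)
    (hγ : γ • z ∈ ModularGroup.fd) :
    γ = 1 ∨ (γ = T ∧ z.re = -1 / 2) ∨ (γ = T⁻¹ ∧ z.re = 1 / 2) ∨
      (‖(z : ℂ)‖ = 1 ∧ ‖((γ • z : ℍ) : ℂ)‖ = 1) := by
  have h1 := fd_cases' hz hγ
  have h2 := fd_cases' (γ := γ⁻¹) hγ (by rwa [inv_smul_smul])
  rw [inv_eq_one, inv_eq_iff_eq_inv, inv_inj] at h2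
  rcases h1 with h | h | h | ⟨rfl, h⟩ | h | h
  · exact Or.inl h
  · exact Or.inr (Or.inl h)
  · exact Or.inr (Or.inr (Or.inl h))
  · exact Or.inr (Or.inr (Or.inr ⟨h, S_smul_norm h⟩))
  all_goals
    rcases h2 with k | k | k | k | k | k
    · exact Or.inl k
    · have hre := T_inv_smul_re z
      rw [← k.1, k.2] at hre
      exact Or.inr (Or.inr (Or.inl ⟨k.1, by linarith⟩))
    · have hre := T_smul_re z
      rw [← k.1, k.2] at hre
      exact Or.inr (Or.inl ⟨k.1, by linarith⟩)
    · exact Or.inr (Or.inr (Or.inr ⟨h.1, k.2⟩))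
    · exact Or.inr (Or.inr (Or.inr ⟨h.1, k.1⟩))
    · exact Or.inr (Or.inr (Or.inr ⟨h.1, k.1⟩))

theorem arc_re (t : I) : (arc t).re = t / 2 := rfl

theorem arc_im (t : I) : (arc t).im = Real.sqrt (1 - (t / 2 : ℝ) ^ 2) := rfl

theorem arc_injective : Function.Injective arc := fun s t h => by
  have := congrArg UpperHalfPlane.re h
  rw [arc_re, arc_re] at this
  exact Subtype.ext (by linarith)

theorem continuous_arc : Continuous arc := by
  refine Continuous.upperHalfPlaneMk ?_ _
  have h : Continuous fun t : I => (t : ℝ) := continuous_subtype_val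
  have : Continuous fun t : I => ((t / 2 : ℝ) : ℂ) + (√(1 - (t / 2 : ℝ) ^ 2) : ℝ) * Complex.I := by
    fun_prop
  convert this using 2 with t
  apply Complex.ext <;> simp [Complex.add_re, Complex.add_im]

theorem norm_arc (t : I) : ‖(arc t : ℂ)‖ = 1 := by
  have h0 := t.2.1
  have h1 := t.2.2
  have h2 : (0 : ℝ) ≤ 1 - (t / 2 : ℝ) ^ 2 := by nlinarith
  rw [Complex.norm_def, Complex.normSq_apply, UpperHalfPlane.coe_re, UpperHalfPlane.coe_im,
    arc_re, arc_im, Real.mul_self_sqrt h2, ← pow_two, add_sub_cancel, Real.sqrt_one]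

theorem eq_arc {z : ℍ} (hz : ‖(z : ℂ)‖ = 1) {t : I} (h : z.re = t / 2) : z = arc t :=
  UpperHalfPlane.eq_of_re_of_norm h (hz.trans (norm_arc t).symm)

theorem arc_mem_fd (t : I) : arc t ∈ ModularGroup.fd := by
  refine ⟨?_, ?_⟩
  · rw [Complex.normSq_eq_norm_sq, norm_arc, one_pow]
  · rw [arc_re, abs_of_nonneg (div_nonneg t.2.1 (by norm_num))]
    linarith [t.2.2]

theorem S_smul_arc_zero : S • arc 0 = arc 0 :=
  eq_arc (S_smul_norm (norm_arc 0)) (by rw [S_smul_re (norm_arc 0), arc_re]; simp)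

theorem L_smul_arc_one : L • arc 1 = arc 1 := by
  rw [L_eq, mul_smul]
  refine UpperHalfPlane.ext_re_im ?_ ?_
  · rw [T_smul_re, S_smul_re (norm_arc 1), arc_re, Set.Icc.coe_one]
    norm_num
  · rw [T_smul_im, S_smul_im (norm_arc 1)]

/-- The arc is a strict fundamental domain for the Farey tree, with trivial stabilizers inside,
`⟨S⟩` at the white end and `⟨L⟩` at the black end. All gluing in the covers is read off from this.
-/
theorem eq_of_smul_arc_eq {γ : Modular} {s t : I} (h : γ • arc s = arc t) :
    s = t ∧ (γ = 1 ∨ (s = 0 ∧ γ = S) ∨ (s = 1 ∧ (γ = L ∨ γ = L ^ 2))) := by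
  have hre : (γ • arc s).re = t / 2 := by rw [h, arc_re]
  have hs0 := s.2.1
  have hs1 := s.2.2
  have ht0 := t.2.1
  have ht1 := t.2.2
  rcases fd_cases' (arc_mem_fd s) (h ▸ arc_mem_fd t) with
    rfl | ⟨rfl, h1⟩ | ⟨rfl, h1⟩ | ⟨rfl, h1⟩ | ⟨h0, h1, h2⟩ | ⟨h0, h1⟩
  · rw [one_smul] at h
    exact ⟨arc_injective h, Or.inl rfl⟩
  · rw [arc_re] at h1
    linarith
  · rw [T_inv_smul_re] at hre
    rw [arc_re] at h1 hre
    linarith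
  · rw [S_smul_re h1, arc_re] at hre
    have hs : s = 0 := Subtype.ext (by rw [Set.Icc.coe_zero]; linarith)
    have ht : t = 0 := Subtype.ext (by rw [Set.Icc.coe_zero]; linarith)
    exact ⟨hs.trans ht.symm, Or.inr (Or.inl ⟨hs, rfl⟩)⟩
  · rw [arc_re] at h1
    have hs : s = 1 := Subtype.ext (by rw [Set.Icc.coe_one]; linarith)
    subst hs
    rcases h2 with rfl | rfl | rfl
    · exact ⟨arc_injective (L_smul_arc_one.symm.trans h), Or.inr (Or.inr ⟨rfl, Or.inl rfl⟩)⟩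
    · rw [pow_two, mul_smul, L_smul_arc_one, L_smul_arc_one] at h
      exact ⟨arc_injective h, Or.inr (Or.inr ⟨rfl, Or.inr rfl⟩)⟩
    -- The third element is `T⁻¹ * L ^ 2`, which moves the right corner to the left one, off the
    -- arc.
    · rw [mul_assoc, ← L_sq_eq, mul_smul, pow_two, mul_smul, L_smul_arc_one, L_smul_arc_one,
        T_inv_smul_re, arc_re, Set.Icc.coe_one] at hre
      linarith
  · rw [arc_re] at h1
    linarith

theorem basePt_mem_free : basePt ∈ free := by
  intro γ hγ
  rcases (eq_of_smul_arc_eq hγ).2 with h | ⟨h, -⟩ | ⟨h, -⟩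
  · exact h
  · have := congrArg Subtype.val h
    norm_num [half] at this
  · have := congrArg Subtype.val h
    norm_num [half] at this

/-! ## The equivariant deformation retraction onto the Farey tree -/

/-- In `im z / |c z + d|²` the denominator is at least `1` if `c = 0`, and at least `(im z)²`
otherwise. The bound does not depend on `γ`. -/
theorem im_smul_le (γ : Modular) (z : ℍ) : (γ • z).im ≤ max z.im (1 / z.im) := by
  induction γ using induction_modular with | h g => ?_
  have hz := z.im_pos
  rw [mk_smul, ModularGroup.im_smul_eq_div_normSq]
  have hd : UpperHalfPlane.denom (g : GL (Fin 2) ℝ) z = (g 1 0 : ℂ) * z + g 1 1 := by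
    simp [ModularGroup.denom_apply]
  rw [hd]
  by_cases hc : g 1 0 = 0
  · have had := g.det_coe
    rw [Matrix.det_fin_two, hc, mul_zero, sub_zero] at had
    have h1 : (1 : ℝ) ≤ Complex.normSq ((g 1 0 : ℂ) * z + g 1 1) := by
      rw [hc, Int.cast_zero, zero_mul, zero_add, Complex.normSq_intCast]
      have : g 1 1 ≠ 0 := right_ne_zero_of_mul_eq_one had
      have : 1 ≤ g 1 1 * g 1 1 := (mul_self_pos.2 this)
      exact_mod_cast this
    exact (div_le_self hz.le h1).trans (le_max_left _ _)
  · have h1 : z.im ^ 2 ≤ Complex.normSq ((g 1 0 : ℂ) * z + g 1 1) := by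
      have h2 : (1 : ℝ) ≤ (g 1 0 : ℝ) ^ 2 := by
        have : 1 ≤ (g 1 0) ^ 2 := sq_pos_of_ne_zero hc
        exact_mod_cast this
      have h3 : ((g 1 0 : ℂ) * z + g 1 1).im = g 1 0 * z.im := by simp
      rw [Complex.normSq_apply, h3]
      nlinarith [mul_self_nonneg ((g 1 0 : ℂ) * z + g 1 1).re, sq_nonneg z.im]
    refine le_trans ?_ (le_max_right _ _)
    rw [div_le_div_iff₀ ((pow_pos hz 2).trans_le h1) hz]
    nlinarith

/-- The fundamental domain is not compact, but the uniform bound on imaginary parts shows that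
translates meeting a closed ball already meet it in translates of a truncated, hence compact,
domain. Proper discontinuity then applies. -/
theorem locallyFinite_smul_fd :
    LocallyFinite fun γ : Modular => {z : ℍ | γ⁻¹ • z ∈ ModularGroup.fd} := by
  intro z
  refine ⟨Metric.closedBall z 1, Metric.closedBall_mem_nhds z one_pos, ?_⟩
  have hK : IsCompact (Metric.closedBall z 1) := isCompact_closedBall z 1
  have hcont : ContinuousOn (fun w : ℍ => max w.im (1 / w.im)) (Metric.closedBall z 1) :=
    (UpperHalfPlane.continuous_im.max (continuous_const.div UpperHalfPlane.continuous_im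
      fun w => w.im_ne_zero)).continuousOn
  obtain ⟨B, hB⟩ := (hK.image_of_continuousOn hcont).bddAbove
  refine (ProperlyDiscontinuousSMul.finite_disjoint_inter_image (Γ := Modular)
    (ModularGroup.isCompact_truncatedFundamentalDomain B) hK).subset ?_
  rintro γ ⟨w, hw, hwK⟩
  exact ⟨w, ⟨γ⁻¹ • w, ⟨hw, (im_smul_le _ _).trans (hB ⟨w, hwK, rfl⟩)⟩, smul_inv_smul γ w⟩, hwK⟩

theorem exists_smul_mem_fd (z : ℍ) : ∃ γ : Modular, γ • z ∈ ModularGroup.fd :=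
  let ⟨g, hg⟩ := ModularGroup.exists_smul_mem_fd z
  ⟨QuotientGroup.mk g, hg⟩

/-- A vertical homotopy which, on the strip `|re z| ≤ 1 / 2`, projects to the unit circle. -/
def verticalHomotopy (t : I) (z : ℍ) : ℍ :=
  ⟨⟨z.re, (1 - t) * z.im + t * √(max (1 - z.re ^ 2) (3 / 4))⟩, by
    have h0 := t.2.1
    have h1 := t.2.2
    have h2 : 0 < √(max (1 - z.re ^ 2) (3 / 4)) :=
      Real.sqrt_pos.2 (lt_max_of_lt_right (by norm_num))
    have h3 := z.im_pos
    change 0 < (1 - (t : ℝ)) * z.im + t * √(max (1 - z.re ^ 2) (3 / 4))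
    rcases h0.eq_or_lt with h | h
    · rw [← h]; simpa using h3
    · nlinarith [mul_pos h h2, mul_nonneg (sub_nonneg.2 h1) h3.le]⟩

theorem verticalHomotopy_re (t : I) (z : ℍ) : (verticalHomotopy t z).re = z.re := rfl

theorem verticalHomotopy_im (t : I) (z : ℍ) : (verticalHomotopy t z).im =
    (1 - t) * z.im + t * √(max (1 - z.re ^ 2) (3 / 4)) := rfl

theorem continuous_verticalHomotopy :
    Continuous fun x : I × ℍ => verticalHomotopy x.1 x.2 := by
  refine Continuous.upperHalfPlaneMk ?_ _
  have h1 : Continuous fun x : I × ℍ => (x.1 : ℝ) := by fun_prop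
  have h2 : Continuous fun x : I × ℍ => x.2.re := UpperHalfPlane.continuous_re.comp continuous_snd
  have h3 : Continuous fun x : I × ℍ => x.2.im := UpperHalfPlane.continuous_im.comp continuous_snd
  have h4 : Continuous fun x : I × ℍ =>
      (1 - x.1 : ℝ) * x.2.im + x.1 * √(max (1 - x.2.re ^ 2) (3 / 4)) := by fun_prop
  have : Continuous fun x : I × ℍ => (x.2.re : ℂ) +
      (((1 - x.1 : ℝ) * x.2.im + x.1 * √(max (1 - x.2.re ^ 2) (3 / 4)) : ℝ) : ℂ) * Complex.I :=
    (Complex.continuous_ofReal.comp h2).add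
      ((Complex.continuous_ofReal.comp h4).mul continuous_const)
  convert this using 2 with x
  apply Complex.ext <;> simp [Complex.add_re, Complex.add_im]

theorem verticalHomotopy_zero (z : ℍ) : verticalHomotopy 0 z = z :=
  UpperHalfPlane.ext_re_im rfl (by rw [verticalHomotopy_im]; simp)

/-- On the strip `|re z| ≤ 1 / 2` the cut-off at `3 / 4` is inactive; it only keeps the homotopy
inside `ℍ` elsewhere. -/
theorem max_eq_of_mem_fd {z : ℍ} (hz : z ∈ ModularGroup.fd) :
    max (1 - z.re ^ 2) (3 / 4) = 1 - z.re ^ 2 := by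
  refine max_eq_left ?_
  have := abs_le.1 hz.2
  nlinarith

theorem verticalHomotopy_of_norm_eq {z : ℍ} (hz : z ∈ ModularGroup.fd) (h : ‖(z : ℂ)‖ = 1)
    (t : I) : verticalHomotopy t z = z := by
  refine UpperHalfPlane.ext_re_im rfl ?_
  have h1 : 1 - z.re ^ 2 = z.im ^ 2 := by
    have := Complex.normSq_eq_norm_sq (z : ℂ)
    rw [h, Complex.normSq_apply, UpperHalfPlane.coe_re, UpperHalfPlane.coe_im] at this
    linarith
  rw [verticalHomotopy_im, max_eq_of_mem_fd hz, h1, Real.sqrt_sq z.im_pos.le]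
  ring

theorem norm_verticalHomotopy_one {z : ℍ} (hz : z ∈ ModularGroup.fd) :
    ‖(verticalHomotopy 1 z : ℂ)‖ = 1 := by
  have h2 : 0 ≤ 1 - z.re ^ 2 := by
    have := abs_le.1 hz.2
    nlinarith
  rw [Complex.norm_def, Complex.normSq_apply, UpperHalfPlane.coe_re, UpperHalfPlane.coe_im,
    verticalHomotopy_re, verticalHomotopy_im, max_eq_of_mem_fd hz]
  simp [Real.mul_self_sqrt h2, ← pow_two]

/-- Translation between the vertical sides preserves the height and `(re z)²`, and points of the
unit circle do not move at all. -/
theorem verticalHomotopy_smul {γ : Modular} {z : ℍ} (hz : z ∈ ModularGroup.fd)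
    (hγ : γ • z ∈ ModularGroup.fd) (t : I) :
    verticalHomotopy t (γ • z) = γ • verticalHomotopy t z := by
  rcases fd_cases hz hγ with rfl | ⟨rfl, h⟩ | ⟨rfl, h⟩ | ⟨h, h'⟩
  · rw [one_smul, one_smul]
  · refine UpperHalfPlane.ext_re_im ?_ ?_
    · rw [T_smul_re, verticalHomotopy_re, verticalHomotopy_re, T_smul_re]
    · rw [T_smul_im, verticalHomotopy_im, verticalHomotopy_im, T_smul_re, T_smul_im, h]
      norm_num
  · refine UpperHalfPlane.ext_re_im ?_ ?_
    · rw [T_inv_smul_re, verticalHomotopy_re, verticalHomotopy_re, T_inv_smul_re]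
    · rw [T_inv_smul_im, verticalHomotopy_im, verticalHomotopy_im, T_inv_smul_re, T_inv_smul_im, h]
      norm_num
  · rw [verticalHomotopy_of_norm_eq hz h, verticalHomotopy_of_norm_eq hγ h']

/-- The equivariant extension of the vertical homotopy of the fundamental domain. -/
def retraction (x : I × ℍ) : ℍ :=
  (exists_smul_mem_fd x.2).choose⁻¹ •
    verticalHomotopy x.1 ((exists_smul_mem_fd x.2).choose • x.2)

/-- The chosen element may be replaced by any other that moves `z` into the fundamental domain,
since the vertical push respects the side pairings. -/
theorem retraction_of_smul_mem_fd {γ : Modular} {z : ℍ} (h : γ • z ∈ ModularGroup.fd) (t : I) :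
    retraction (t, z) = γ⁻¹ • verticalHomotopy t (γ • z) := by
  have hδ := (exists_smul_mem_fd z).choose_spec
  rw [retraction]
  dsimp only
  set δ := (exists_smul_mem_fd z).choose
  have h1 : γ • z = (γ * δ⁻¹) • δ • z := by rw [mul_smul, inv_smul_smul]
  rw [h1, verticalHomotopy_smul hδ (h1 ▸ h), mul_smul, inv_smul_smul]

theorem retraction_smul (γ : Modular) (t : I) (z : ℍ) :
    retraction (t, γ • z) = γ • retraction (t, z) := by
  obtain ⟨δ, hδ⟩ := exists_smul_mem_fd z
  have h : (δ * γ⁻¹) • γ • z = δ • z := by rw [mul_smul, inv_smul_smul]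
  rw [retraction_of_smul_mem_fd hδ, retraction_of_smul_mem_fd (h.symm ▸ hδ), h, mul_inv_rev,
    inv_inv, mul_smul]

/-- Pasting over the locally finite closed cover by translates of the fundamental domain, on each of
which a single group element can be used. -/
theorem continuous_retraction : Continuous retraction := by
  have hcl (γ : Modular) : IsClosed {z : ℍ | γ⁻¹ • z ∈ ModularGroup.fd} :=
    ModularGroup.isClosed_fd.preimage (continuous_const_smul γ⁻¹)
  refine (locallyFinite_smul_fd.preimage_continuous continuous_snd).continuous ?_
    (fun γ => (hcl γ).preimage continuous_snd) fun γ => ?_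
  · refine Set.eq_univ_of_forall fun x => ?_
    obtain ⟨γ, hγ⟩ := exists_smul_mem_fd x.2
    exact Set.mem_iUnion.2 ⟨γ⁻¹, by simpa using hγ⟩
  · have : Continuous fun x : I × ℍ => γ • verticalHomotopy x.1 (γ⁻¹ • x.2) :=
      (continuous_verticalHomotopy.comp
        (continuous_fst.prodMk (continuous_snd.const_smul γ⁻¹))).const_smul γ
    refine this.continuousOn.congr fun x hx => ?_
    have := retraction_of_smul_mem_fd (γ := γ⁻¹) (z := x.2) hx x.1
    rwa [inv_inv] at this

theorem mem_fareyTree_of_norm_eq {z : ℍ} (hz : z ∈ ModularGroup.fd) (h : ‖(z : ℂ)‖ = 1) :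
    z ∈ fareyTree := by
  have h1 := abs_le.1 hz.2
  rcases le_total 0 z.re with h0 | h0
  · refine ⟨1, ⟨2 * z.re, by linarith, by linarith⟩, ?_⟩
    rw [one_smul]
    exact eq_arc h (by simp)
  · refine ⟨S⁻¹, ⟨2 * -z.re, by linarith, by linarith⟩, ?_⟩
    rw [eq_inv_smul_iff]
    exact eq_arc (S_smul_norm h) (by rw [S_smul_re h]; simp; ring)

theorem smul_mem_fareyTree {z : ℍ} (hz : z ∈ fareyTree) (γ : Modular) : γ • z ∈ fareyTree := by
  obtain ⟨δ, t, rfl⟩ := hz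
  exact ⟨γ * δ, t, (mul_smul _ _ _).symm⟩

theorem isDeformationRetraction_retraction : IsDeformationRetraction retraction fareyTree where
  continuous := continuous_retraction
  start z := by
    obtain ⟨γ, hγ⟩ := exists_smul_mem_fd z
    rw [retraction_of_smul_mem_fd hγ, verticalHomotopy_zero, inv_smul_smul]
  finish z := by
    obtain ⟨γ, hγ⟩ := exists_smul_mem_fd z
    rw [retraction_of_smul_mem_fd hγ]
    refine smul_mem_fareyTree (mem_fareyTree_of_norm_eq ⟨?_, ?_⟩
      (norm_verticalHomotopy_one hγ)) _
    · rw [Complex.normSq_eq_norm_sq, norm_verticalHomotopy_one hγ, one_pow]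
    · exact hγ.2
  fixed t z hz := by
    obtain ⟨γ, s, rfl⟩ := hz
    have h : γ⁻¹ • γ • arc s = arc s := inv_smul_smul _ _
    rw [retraction_of_smul_mem_fd (h.symm ▸ arc_mem_fd s), h,
      verticalHomotopy_of_norm_eq (arc_mem_fd s) (norm_arc s), inv_inv]

/-! ## Lifts -/

-- Join `a` to `b` by two segments through a point `c + t • y`, where `c` is the midpoint and `y` is
-- not parallel to `b - a`. For different `t` the segments from one endpoint meet only there, so
-- countably many `t` are bad, while the `t` with `c + t • y ∈ A` form an open neighbourhood of `0`.
open Set in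
theorem _root_.Convex.isPreconnected_diff_countable {E : Type*} [AddCommGroup E] [Module ℝ E]
    [TopologicalSpace E] [ContinuousAdd E] [ContinuousSMul ℝ E] (h : 1 < Module.rank ℝ E)
    {A s : Set E} (hA : Convex ℝ A) (hAo : IsOpen A) (hs : s.Countable) :
    IsPreconnected (A \ s) := by
  have : Nontrivial E := (rank_pos_iff_nontrivial (R := ℝ)).1 (zero_lt_one.trans h)
  refine isPreconnected_of_forall_pair fun a ha b hb => ?_
  suffices h : JoinedIn (A \ s) a b by
    refine ⟨range h.somePath, ?_, ⟨0, by simp⟩, ⟨1, by simp⟩,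
      isPreconnected_range h.somePath.continuous⟩
    rintro _ ⟨t, rfl⟩
    exact h.somePath_mem t
  rcases eq_or_ne a b with rfl | hab
  · exact JoinedIn.refl ha
  let c := (2 : ℝ)⁻¹ • (a + b)
  let x := (2 : ℝ)⁻¹ • (b - a)
  have Ia : c - x = a := by
    simp only [c, x]
    module
  have Ib : c + x = b := by
    simp only [c, x]
    module
  have hc : c ∈ A := by
    have := hA ha.1 hb.1 (a := (2 : ℝ)⁻¹) (b := (2 : ℝ)⁻¹) (by norm_num) (by norm_num) (by norm_num)
    rwa [← smul_add] at this
  have x_ne_zero : x ≠ 0 := by simpa [x] using sub_ne_zero.2 hab.symm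
  obtain ⟨y, hy⟩ : ∃ y, LinearIndependent ℝ ![x, y] :=
    exists_linearIndependent_pair_of_one_lt_rank h x_ne_zero
  have H : ∀ x' : E, LinearIndependent ℝ ![x', y] → c + x' ∉ s →
      Set.Countable {t : ℝ | (segment ℝ (c + x') (c + t • y) ∩ s).Nonempty} := by
    intro x' hy' hx'
    apply countable_ofPred_nonempty_of_disjoint _ (fun t ↦ inter_subset_right) hs
    intro t t' htt'
    apply disjoint_iff_inter_eq_empty.2
    have N : {c + x'} ∩ s = ∅ := by
      simpa only [singleton_inter_eq_empty, mem_compl_iff] using hx'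
    rw [inter_assoc, inter_comm s, inter_assoc, inter_self, ← inter_assoc, ← subset_empty_iff, ← N]
    apply inter_subset_inter_left
    apply Eq.subset
    apply segment_inter_eq_endpoint_of_linearIndependent_of_ne hy' htt'.symm
  have hy' : LinearIndependent ℝ ![-x, y] := by
    convert! hy.units_smul ![-1, 1]
    simp [← List.ofFn_inj]
  have h1 := H x hy (Ib.symm ▸ hb.2)
  have h2 := H (-x) hy' (by rw [← sub_eq_add_neg, Ia]; exact ha.2)
  have hO : IsOpen {t : ℝ | c + t • y ∈ A} := hAo.preimage (by fun_prop)
  obtain ⟨t, htA, ht⟩ := ((h1.union h2).dense_compl ℝ).inter_open_nonempty _ hO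
    ⟨0, by simpa using hc⟩
  simp only [compl_union, mem_inter_iff, mem_compl_iff, mem_ofPred_eq,
    not_nonempty_iff_eq_empty] at ht
  rw [← sub_eq_add_neg, Ia, Ib] at ht
  have J : ∀ e ∈ A, segment ℝ e (c + t • y) ∩ s = ∅ → JoinedIn (A \ s) e (c + t • y) := by
    intro e he hes
    apply JoinedIn.of_segment_subset
    exact subset_sdiff.2 ⟨hA.segment_subset he htA, disjoint_iff_inter_eq_empty.2 hes⟩
  exact (J a ha.1 ht.2).trans (J b hb.1 ht.1).symm

/-- An open subset of `ℍ` which is convex as a subset of `ℂ`. -/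
structure IsConvexOpen (A : Set ℍ) : Prop where
  isOpen : IsOpen A
  convex : Convex ℝ ((↑) '' A : Set ℂ)

namespace IsConvexOpen

variable {A B : Set ℍ}

theorem inter (hA : IsConvexOpen A) (hB : IsConvexOpen B) : IsConvexOpen (A ∩ B) where
  isOpen := hA.isOpen.inter hB.isOpen
  convex := by
    rw [Set.image_inter UpperHalfPlane.coe_injective]
    exact hA.convex.inter hB.convex

theorem isPreconnected_inter_free (hA : IsConvexOpen A) : IsPreconnected (A ∩ free) := by
  rw [← UpperHalfPlane.isEmbedding_coe.isInducing.isPreconnected_image]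
  have : ((↑) '' (A ∩ free) : Set ℂ) = (↑) '' A \ (↑) '' freeᶜ := by
    rw [← Set.image_sdiff UpperHalfPlane.coe_injective, Set.sdiff_compl]
  rw [this]
  exact hA.convex.isPreconnected_diff_countable (by simp)
    (UpperHalfPlane.isOpenEmbedding_coe.isOpenMap _ hA.isOpen) (countable_compl_free.image _)

end IsConvexOpen

theorem isConvexOpen_univ : IsConvexOpen Set.univ where
  isOpen := isOpen_univ
  convex := by
    rw [Set.image_univ, UpperHalfPlane.range_coe]
    exact convex_halfSpace_im_gt 0

theorem isConvexOpen_ball (z : ℍ) (r : ℝ) : IsConvexOpen (Metric.ball z r) where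
  isOpen := Metric.isOpen_ball
  convex := by
    rw [UpperHalfPlane.image_coe_ball]
    exact convex_ball _ _

theorem exists_mem_free {O : Set ℍ} (hO : IsOpen O) (hne : O.Nonempty) : (O ∩ free).Nonempty := by
  obtain ⟨w, hw⟩ := hne
  obtain ⟨u, ⟨v, hv, rfl⟩, hu⟩ :=
    ((countable_compl_free.image ((↑) : ℍ → ℂ)).dense_compl ℝ).inter_open_nonempty _
    (UpperHalfPlane.isOpenEmbedding_coe.isOpenMap _ hO) ⟨w, w, hw, rfl⟩
  refine ⟨v, hv, ?_⟩
  by_contra h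
  exact hu ⟨v, h, rfl⟩

/-! ### Lifts over orbifold charts: uniqueness and gluing. -/

variable {X : Type} [TopologicalSpace X] {p : X → Orb}

/-- `f` restricts to a continuous lift of `toOrb` on `A`. -/
structure IsLiftOn (p : X → Orb) (f : ℍ → X) (A : Set ℍ) : Prop where
  continuousOn : ContinuousOn f A
  proj : ∀ z ∈ A, p (f z) = toOrb z

theorem IsLiftOn.mono {f : ℍ → X} {A B : Set ℍ} (h : IsLiftOn p f B) (hAB : A ⊆ B) :
    IsLiftOn p f A :=
  ⟨h.continuousOn.mono hAB, fun z hz => h.proj z (hAB hz)⟩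

theorem IsLiftOn.comp_smul {f : ℍ → X} {A B : Set ℍ} (h : IsLiftOn p f B) (γ : Modular)
    (hAB : ∀ z ∈ A, γ • z ∈ B) : IsLiftOn p (fun z => f (γ • z)) A :=
  ⟨h.continuousOn.comp (continuous_const_smul γ).continuousOn hAB,
    fun z hz => (h.proj _ (hAB z hz)).trans (toOrb_smul γ z)⟩

/-- An orbifold chart over a metric ball. -/
structure BallChart (p : X → Orb) (z : ℍ) where
  r : ℝ
  r_pos : 0 < r
  stab : ∀ γ : Modular, ∀ u ∈ Metric.ball z r, γ • u ∈ Metric.ball z r → γ • z = z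
  ι : Type
  V : ι → Set X
  φ : ι → ℍ → X
  isOpen_V : ∀ i, IsOpen (V i)
  disjoint : ∀ i j x, x ∈ V i → x ∈ V j → i = j
  cover : ∀ x, ∀ w ∈ Metric.ball z r, p x = toOrb w → ∃ i, x ∈ V i
  isLiftOn : ∀ i, IsLiftOn p (φ i) (Metric.ball z r)
  mapsTo : ∀ i, ∀ u ∈ Metric.ball z r, φ i u ∈ V i
  surj : ∀ i, ∀ x ∈ V i, ∃ u ∈ Metric.ball z r, φ i u = x
  isOpen_image : ∀ i, ∀ O ⊆ Metric.ball z r, IsOpen O → IsOpen (φ i '' O)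
  fibre : ∀ i, ∀ u ∈ Metric.ball z r, ∀ u' ∈ Metric.ball z r, φ i u = φ i u' →
    ∃ k : Modular, k • z = z ∧ k • u = u' ∧ ∀ v ∈ Metric.ball z r, φ i (k • v) = φ i v

/-- The group acts by isometries, so a ball around `z` is invariant under the stabilizer of `z`. A
given chart can therefore be restricted to a ball inside it, each sheet shrinking to the image of
the ball. -/
theorem IsOrbifoldCover.nonempty_ballChart (hp : IsOrbifoldCover p) (z : ℍ) :
    Nonempty (BallChart p z) := by
  classical
  obtain ⟨U, hU, hzU, hinv, hstab, ι, V, K, φ, hV, hdisj, hcov, hφ⟩ := hp.chart z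
  obtain ⟨r, hr, hrU⟩ := Metric.isOpen_iff.1 hU z hzU
  choose hK hcont hopen hrange hproj hfib using hφ
  have hst : ∀ γ : Modular, ∀ u ∈ Metric.ball z r, γ • u ∈ Metric.ball z r → γ • z = z :=
    fun γ u hu hγ => hstab γ u (hrU hu) (hrU hγ)
  -- The value outside `U` is arbitrary; total functions avoid subtypes later.
  let ψ : ι → ℍ → X := fun i u => if h : u ∈ U then φ i ⟨u, h⟩ else φ i ⟨z, hzU⟩
  have hψ : ∀ i u (h : u ∈ U), ψ i u = φ i ⟨u, h⟩ := fun i u h => dif_pos h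
  have himage : ∀ i, ∀ O ⊆ Metric.ball z r, IsOpen O → IsOpen (ψ i '' O) := by
    intro i O hO hOo
    have : ψ i '' O = φ i '' (Subtype.val ⁻¹' O) := by
      ext x
      constructor
      · rintro ⟨u, hu, rfl⟩
        exact ⟨⟨u, hrU (hO hu)⟩, hu, (hψ i u _).symm⟩
      · rintro ⟨⟨u, hu'⟩, hu, rfl⟩
        exact ⟨u, hu, hψ i u _⟩
    rw [this]
    exact hopen i _ (hOo.preimage continuous_subtype_val)
  have hmem : ∀ i u, u ∈ U → ψ i u ∈ V i := fun i u hu => by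
    rw [hψ i u hu, ← hrange i]
    exact Set.mem_range_self _
  refine ⟨⟨r, hr, hst, ι, fun i => ψ i '' Metric.ball z r, ψ, fun i => himage i _ subset_rfl
    Metric.isOpen_ball, ?_, ?_, fun i => ⟨?_, ?_⟩, fun i u hu => ⟨u, hu, rfl⟩, fun i x hx => hx,
    himage, ?_⟩⟩
  · rintro i j _ ⟨u, hu, rfl⟩ ⟨v, hv, hv'⟩
    by_contra hij
    exact Set.disjoint_left.1 (hdisj hij) (hmem i u (hrU hu)) (hv' ▸ hmem j v (hrU hv))
  · intro x w hw hx
    have : x ∈ ⋃ i, V i := by rw [hcov]; exact ⟨w, hrU hw, hx.symm⟩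
    obtain ⟨i, hi⟩ := Set.mem_iUnion.1 this
    rw [← hrange i] at hi
    obtain ⟨⟨u, hu⟩, rfl⟩ := hi
    rw [hproj] at hx
    obtain ⟨γ, rfl⟩ := toOrb_eq_iff.1 hx
    exact ⟨i, γ • w, smul_mem_ball (hstab γ w (hrU hw) hu) hw, hψ i _ hu⟩
  · have : ContinuousOn (ψ i) U := by
      rw [continuousOn_iff_continuous_domRestrict]
      exact (hcont i).congr fun u => (hψ i u u.2).symm
    exact this.mono hrU
  · intro u hu
    rw [hψ i u (hrU hu), hproj]
  · intro i u hu u' hu' h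
    rw [hψ i u (hrU hu), hψ i u' (hrU hu'), hfib] at h
    obtain ⟨k, hk, hku⟩ := h
    refine ⟨k, hK i hk, hku, fun v hv => ?_⟩
    have hkv : k • v ∈ U := hinv k (hK i hk) v (hrU hv)
    rw [hψ i v (hrU hv), hψ i _ hkv, eq_comm, hfib]
    exact ⟨k, hk, rfl⟩

namespace BallChart

variable {z : ℍ}

theorem mem_ball (c : BallChart p z) : z ∈ Metric.ball z c.r := Metric.mem_ball_self c.r_pos

theorem exists_eq (c : BallChart p z) {i : c.ι} {x : X} (hx : x ∈ c.V i) {w : ℍ}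
    (hw : w ∈ Metric.ball z c.r) (hxw : p x = toOrb w) :
    ∃ γ : Modular, γ • z = z ∧ c.φ i (γ • w) = x := by
  obtain ⟨u, hu, rfl⟩ := c.surj i x hx
  rw [(c.isLiftOn i).proj u hu] at hxw
  obtain ⟨γ, rfl⟩ := toOrb_eq_iff.1 hxw
  exact ⟨γ, c.stab γ w hw hu, rfl⟩

/-- A sheet is a quotient of the ball by a subgroup of the stabilizer of its centre, so only one of
its points lies over the centre. -/
theorem eq_center (c : BallChart p z) {i : c.ι} {x : X} (hx : x ∈ c.V i) (hxz : p x = toOrb z) :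
    x = c.φ i z := by
  obtain ⟨γ, h1, rfl⟩ := c.exists_eq hx c.mem_ball hxz
  rw [h1]

theorem isLiftOn_smul (c : BallChart p z) (i : c.ι) {γ : Modular} (hγ : γ • z = z) :
    IsLiftOn p (fun u => c.φ i (γ • u)) (Metric.ball z c.r) :=
  (c.isLiftOn i).comp_smul γ fun _ hu => smul_mem_ball hγ hu

end BallChart

/-- Near a free point two lifts lie in the same sheet and agree, or in different sheets and differ,
so connectedness of `A ∩ free` settles the free points. Near any other point a free one puts both
lifts in one sheet, and this has a single point over its centre. The starting point has to be free:
at a fixed point of `γ`, a lift `f` always agrees with `f ∘ γ`. -/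
theorem IsLiftOn.eqOn (hp : IsOrbifoldCover p) {A : Set ℍ} (hA : IsConvexOpen A) {f g : ℍ → X}
    (hf : IsLiftOn p f A) (hg : IsLiftOn p g A) {w : ℍ} (hw : w ∈ A) (hwf : w ∈ free)
    (h : f w = g w) : Set.EqOn f g A := by
  have hnhds : ∀ z ∈ A, ∃ (c : BallChart p z) (i j : c.ι), f z ∈ c.V i ∧ g z ∈ c.V j ∧
      ∀ᶠ u in nhds z, u ∈ A ∧ u ∈ Metric.ball z c.r ∧ f u ∈ c.V i ∧ g u ∈ c.V j := by
    intro z hz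
    obtain ⟨c⟩ := hp.nonempty_ballChart z
    obtain ⟨i, hi⟩ := c.cover (f z) z c.mem_ball (hf.proj z hz)
    obtain ⟨j, hj⟩ := c.cover (g z) z c.mem_ball (hg.proj z hz)
    have hAz := hA.isOpen.mem_nhds hz
    refine ⟨c, i, j, hi, hj, ?_⟩
    filter_upwards [hAz, Metric.ball_mem_nhds z c.r_pos,
      (hf.continuousOn.continuousAt hAz).preimage_mem_nhds ((c.isOpen_V i).mem_nhds hi),
      (hg.continuousOn.continuousAt hAz).preimage_mem_nhds ((c.isOpen_V j).mem_nhds hj)]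
      with u h1 h2 h3 h4 using ⟨h1, h2, h3, h4⟩
  have hfree : ∀ u ∈ A ∩ free, f u = g u := by
    by_contra! hne
    obtain ⟨v, hv, hvne⟩ := hne
    -- Requiring agreement or disagreement on a whole neighbourhood makes both sets open by
    -- construction.
    let O₁ : Set ℍ := {z | ∀ᶠ u in nhds z, u ∈ A → f u = g u}
    let O₂ : Set ℍ := {z | ∀ᶠ u in nhds z, u ∈ A → f u ≠ g u}
    have hO : ∀ z ∈ A ∩ free, (f z = g z → z ∈ O₁) ∧ (f z ≠ g z → z ∈ O₂) := by
      rintro z ⟨hz, hzf⟩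
      obtain ⟨c, i, j, hi, hj, hev⟩ := hnhds z hz
      refine ⟨fun hzz => ?_, fun hzz => ?_⟩
      · obtain rfl := c.disjoint i j _ hi (hzz ▸ hj)
        filter_upwards [hev] with u ⟨hu1, hu2, hu3, hu4⟩ _
        obtain ⟨γ, hγ, h1⟩ := c.exists_eq hu3 hu2 (hf.proj u hu1)
        obtain ⟨δ, hδ, h2⟩ := c.exists_eq hu4 hu2 (hg.proj u hu1)
        rw [← h1, ← h2, hzf γ hγ, hzf δ hδ]
      · have hij : i ≠ j := by
          rintro rfl
          exact hzz ((c.eq_center hi (hf.proj z hz)).trans (c.eq_center hj (hg.proj z hz)).symm)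
        filter_upwards [hev] with u ⟨hu1, hu2, hu3, hu4⟩ _ huu
        exact hij (c.disjoint i j _ hu3 (huu ▸ hu4))
    obtain ⟨z, hz, h1, h2⟩ := hA.isPreconnected_inter_free O₁ O₂ isOpen_setOfPred_eventually_nhds
      isOpen_setOfPred_eventually_nhds (fun z hz => (em (f z = g z)).imp (hO z hz).1 (hO z hz).2)
      ⟨w, ⟨hw, hwf⟩, (hO w ⟨hw, hwf⟩).1 h⟩ ⟨v, hv, (hO v hv).2 hvne⟩
    exact h2.self_of_nhds hz.1 (h1.self_of_nhds hz.1)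
  intro z hz
  obtain ⟨c, i, j, hi, hj, hev⟩ := hnhds z hz
  obtain ⟨O, hO, hOo, hzO⟩ := eventually_nhds_iff.1 hev
  obtain ⟨u, huO, huf⟩ := exists_mem_free hOo ⟨z, hzO⟩
  obtain ⟨hu1, hu2, hu3, hu4⟩ := hO u huO
  obtain rfl := c.disjoint i j _ hu3 (hfree u ⟨hu1, huf⟩ ▸ hu4)
  exact (c.eq_center hi (hf.proj z hz)).trans (c.eq_center hj (hg.proj z hz)).symm

/-- The maps `c.φ i ∘ γ`, with `γ` fixing the centre, take every possible value at a free point, so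
by uniqueness they are all the lifts on the ball. -/
theorem BallChart.exists_eqOn (hp : IsOrbifoldCover p) {z : ℍ} (c : BallChart p z) {f : ℍ → X}
    (hf : IsLiftOn p f (Metric.ball z c.r)) :
    ∃ (i : c.ι) (γ : Modular), γ • z = z ∧
      Set.EqOn f (fun u => c.φ i (γ • u)) (Metric.ball z c.r) := by
  obtain ⟨w, hw, hwf⟩ := exists_mem_free Metric.isOpen_ball ⟨z, c.mem_ball⟩
  obtain ⟨i, hi⟩ := c.cover (f w) w hw (hf.proj w hw)
  obtain ⟨γ, hγ, h⟩ := c.exists_eq hi hw (hf.proj w hw)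
  exact ⟨i, γ, hγ, hf.eqOn hp (isConvexOpen_ball z c.r) (c.isLiftOn_smul i hγ) hw hwf h.symm⟩

/-- Lifts with arbitrary initial values at points with trivial stabilizer exist on `A`. -/
def HasLifts (p : X → Orb) (A : Set ℍ) : Prop :=
  ∀ w ∈ A, w ∈ free → ∀ x, p x = toOrb w → ∃ f, IsLiftOn p f A ∧ f w = x

theorem HasLifts.mono {A B : Set ℍ} (h : HasLifts p B) (hAB : A ⊆ B) : HasLifts p A := by
  intro w hw hwf x hx
  obtain ⟨f, hf, hfw⟩ := h w (hAB hw) hwf x hx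
  exact ⟨f, hf.mono hAB, hfw⟩

theorem BallChart.hasLifts {z : ℍ} (c : BallChart p z) : HasLifts p (Metric.ball z c.r) := by
  intro w hw _ x hx
  obtain ⟨i, hi⟩ := c.cover x w hw hx
  obtain ⟨γ, hγ, h⟩ := c.exists_eq hi hw hx
  exact ⟨_, c.isLiftOn_smul i hγ, h⟩

theorem IsLiftOn.glue {A B : Set ℍ} (hA : IsOpen A) (hB : IsOpen B) {f g : ℍ → X}
    (hf : IsLiftOn p f A) (hg : IsLiftOn p g B) (h : Set.EqOn f g (A ∩ B)) :
    ∃ k, IsLiftOn p k (A ∪ B) ∧ Set.EqOn k f A ∧ Set.EqOn k g B := by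
  classical
  have h1 : Set.EqOn (A.piecewise f g) f A := fun z hz => A.piecewise_eq_of_mem f g hz
  have h2 : Set.EqOn (A.piecewise f g) g B := fun z hz => by
    by_cases hzA : z ∈ A
    · rw [h1 hzA, h ⟨hzA, hz⟩]
    · exact A.piecewise_eq_of_notMem f g hzA
  refine ⟨A.piecewise f g, ⟨?_, ?_⟩, h1, h2⟩
  · exact (hf.continuousOn.congr h1).union_of_isOpen (hg.continuousOn.congr h2) hA hB
  · rintro z (hz | hz)
    · rw [h1 hz, hf.proj z hz]
    · rw [h2 hz, hg.proj z hz]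

/-- The second lift is started at a free point of `A ∩ B` with the value of the first. As `A ∩ B` is
convex, uniqueness makes them agree on all of it. -/
theorem HasLifts.union (hp : IsOrbifoldCover p) {A B : Set ℍ} (hA : IsConvexOpen A)
    (hB : IsConvexOpen B) (hne : (A ∩ B).Nonempty) (h1 : HasLifts p A) (h2 : HasLifts p B) :
    HasLifts p (A ∪ B) := by
  obtain ⟨v, hv, hvf⟩ := exists_mem_free (hA.isOpen.inter hB.isOpen) hne
  rintro w (hw | hw) hwf x hx
  · obtain ⟨f, hf, hfw⟩ := h1 w hw hwf x hx
    obtain ⟨g, hg, hgv⟩ := h2 v hv.2 hvf (f v) (hf.proj v hv.1)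
    obtain ⟨k, hk, hkf, -⟩ := hf.glue hA.isOpen hB.isOpen hg
      ((hf.mono Set.inter_subset_left).eqOn hp (hA.inter hB) (hg.mono Set.inter_subset_right) hv hvf
        hgv.symm)
    exact ⟨k, hk, (hkf hw).trans hfw⟩
  · obtain ⟨g, hg, hgw⟩ := h2 w hw hwf x hx
    obtain ⟨f, hf, hfv⟩ := h1 v hv.1 hvf (g v) (hg.proj v hv.2)
    obtain ⟨k, hk, -, hkg⟩ := hf.glue hA.isOpen hB.isOpen hg
      ((hf.mono Set.inter_subset_left).eqOn hp (hA.inter hB) (hg.mono Set.inter_subset_right) hv hvf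
        hfv)
    exact ⟨k, hk, (hkg hw).trans hgw⟩

/-! ### Existence of lifts on rectangles and on the upper half plane. -/

theorem interval_induction {P : ℝ → ℝ → Prop} {a b δ : ℝ} (hδ : 0 < δ)
    (small : ∀ s t, a ≤ s → s < t → t ≤ b → t - s < δ → P s t)
    (glue : ∀ s t u v, a ≤ s → s < t → t < u → u < v → v ≤ b → P s u → P t v → P s v)
    (hab : a < b) : P a b := by
  have key : ∀ n : ℕ, ∀ t, a < t → t ≤ b → t - a < δ + n * (δ / 2) → P a t := by
    intro n
    induction n with
    | zero =>
      intro t h1 h2 h3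
      exact small a t le_rfl h1 h2 (by simpa using h3)
    | succ n ih =>
      intro t h1 h2 h3
      by_cases h : t - a < δ
      · exact small a t le_rfl h1 h2 h
      · push_cast at h3
        exact glue a (t - 3 * δ / 4) (t - δ / 2) t le_rfl (by linarith) (by linarith)
          (by linarith) h2 (ih _ (by linarith) (by linarith) (by linarith))
          (small _ _ (by linarith) (by linarith) h2 (by linarith))
  obtain ⟨n, hn⟩ := exists_nat_gt ((b - a) / (δ / 2))
  rw [div_lt_iff₀ (by positivity)] at hn
  exact key n b hab le_rfl (by linarith)

/-- Open rectangles. -/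
def rect (a b c d : ℝ) : Set ℍ := {z | (a < z.re ∧ z.re < b) ∧ (c < z.im ∧ z.im < d)}

theorem isConvexOpen_rect (a b c d : ℝ) : IsConvexOpen (rect a b c d) where
  isOpen := ((isOpen_lt continuous_const UpperHalfPlane.continuous_re).inter
    (isOpen_lt UpperHalfPlane.continuous_re continuous_const)).inter
    ((isOpen_lt continuous_const UpperHalfPlane.continuous_im).inter
    (isOpen_lt UpperHalfPlane.continuous_im continuous_const))
  convex := by
    have : ((↑) '' rect a b c d : Set ℂ) = {w | 0 < w.im} ∩ (({w | a < w.re} ∩ {w | w.re < b}) ∩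
        ({w | c < w.im} ∩ {w | w.im < d})) := by
      ext w
      constructor
      · rintro ⟨z, hz, rfl⟩
        exact ⟨z.im_pos, hz⟩
      · rintro ⟨h0, h⟩
        exact ⟨⟨w, h0⟩, h, rfl⟩
    rw [this]
    exact (convex_halfSpace_im_gt 0).inter (((convex_halfSpace_re_gt a).inter
      (convex_halfSpace_re_lt b)).inter ((convex_halfSpace_im_gt c).inter
      (convex_halfSpace_im_lt d)))

theorem rect_nonempty {a b c d : ℝ} (hab : a < b) (hc : 0 < c) (hcd : c < d) :
    (rect a b c d).Nonempty := by
  refine ⟨⟨⟨(a + b) / 2, (c + d) / 2⟩, ?_⟩, ⟨?_, ?_⟩, ?_, ?_⟩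
  · change 0 < (c + d) / 2
    linarith
  · change a < (a + b) / 2
    linarith
  · change (a + b) / 2 < b
    linarith
  · change c < (c + d) / 2
    linarith
  · change (c + d) / 2 < d
    linarith

theorem isCompact_closedRect {a b c d : ℝ} (hc : 0 < c) :
    IsCompact {z : ℍ | (a ≤ z.re ∧ z.re ≤ b) ∧ (c ≤ z.im ∧ z.im ≤ d)} := by
  rw [UpperHalfPlane.isEmbedding_coe.isCompact_iff]
  have : ((↑) '' {z : ℍ | (a ≤ z.re ∧ z.re ≤ b) ∧ (c ≤ z.im ∧ z.im ≤ d)} : Set ℂ) =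
      Set.Icc a b ×ℂ Set.Icc c d := by
    ext w
    constructor
    · rintro ⟨z, hz, rfl⟩
      exact hz
    · rintro h
      exact ⟨⟨w, hc.trans_le h.2.1⟩, h, rfl⟩
  rw [this]
  exact isCompact_Icc.reProdIm isCompact_Icc

theorem dist_lt_of_close {z w : ℍ} {c ε : ℝ} (hc : 0 < c) (hz : c ≤ z.im) (hw : c ≤ w.im)
    (hre : |z.re - w.re| < ε) (him : |z.im - w.im| < ε) : dist z w < 2 * ε / c := by
  refine (UpperHalfPlane.dist_le_dist_coe_div_sqrt z w).trans_lt ?_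
  have h1 : c ≤ √(z.im * w.im) := Real.le_sqrt_of_sq_le (by nlinarith)
  have h2 : dist (z : ℂ) w < 2 * ε := by
    rw [dist_eq_norm]
    refine (Complex.norm_le_abs_re_add_abs_im _).trans_lt ?_
    simp only [Complex.sub_re, Complex.sub_im, UpperHalfPlane.coe_re, UpperHalfPlane.coe_im]
    linarith
  exact (div_le_div_of_nonneg_left dist_nonneg hc h1).trans_lt (by gcongr)

/-- A Lebesgue number for the chart balls makes small rectangles liftable; these are glued
vertically within a narrow column, and then the columns horizontally. -/
theorem hasLifts_rect (hp : IsOrbifoldCover p) {a b c d : ℝ} (hab : a < b) (hc : 0 < c)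
    (hcd : c < d) : HasLifts p (rect a b c d) := by
  let C (z : ℍ) : BallChart p z := (hp.nonempty_ballChart z).some
  obtain ⟨δ, hδ, hball⟩ := lebesgue_number_lemma_of_metric (isCompact_closedRect (a := a) (b := b)
    (d := d) hc) (c := fun z => Metric.ball z (C z).r) (fun _ => Metric.isOpen_ball)
    (fun z _ => Set.mem_iUnion.2 ⟨z, (C z).mem_ball⟩)
  -- Above height `c`, coordinates closer than `ε` give hyperbolic distance below `2 * ε / c`, which
  -- equals `δ` for this `ε`.
  have hε : 0 < δ * c / 2 := by positivity
  have small : ∀ s t u v, a ≤ s → s < t → t ≤ b → c ≤ u → u < v → v ≤ d → t - s < δ * c / 2 →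
      v - u < δ * c / 2 → HasLifts p (rect s t u v) := by
    intro s t u v h1 h2 h3 h4 h5 h6 h7 h8
    obtain ⟨z, hz⟩ := rect_nonempty h2 (hc.trans_le h4) h5
    obtain ⟨i, hi⟩ := hball z ⟨⟨h1.trans hz.1.1.le, hz.1.2.le.trans h3⟩,
      h4.trans hz.2.1.le, hz.2.2.le.trans h6⟩
    refine ((C i).hasLifts).mono (Set.Subset.trans (fun w hw => ?_) hi)
    have := dist_lt_of_close hc (h4.trans hw.2.1.le) (h4.trans hz.2.1.le) (z := w) (w := z)
      (ε := δ * c / 2) (abs_lt.2 ⟨by linarith [hw.1.1, hz.1.2], by linarith [hw.1.2, hz.1.1]⟩)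
      (abs_lt.2 ⟨by linarith [hw.2.1, hz.2.2], by linarith [hw.2.2, hz.2.1]⟩)
    rw [Metric.mem_ball]
    convert this using 1
    field_simp
  refine interval_induction (P := fun s t => HasLifts p (rect s t c d)) hε ?_ ?_ hab
  · intro s t h1 h2 h3 h4
    refine interval_induction (P := fun u v => HasLifts p (rect s t u v)) hε
      (fun u v h5 h6 h7 h8 => small s t u v h1 h2 h3 h5 h6 h7 h4 h8) ?_ hcd
    intro u v u' v' h5 h6 h7 h8 h9 hl hr
    refine (hl.union hp (isConvexOpen_rect _ _ _ _) (isConvexOpen_rect _ _ _ _) ?_ hr).mono ?_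
    · obtain ⟨z, hz⟩ := rect_nonempty h2 (hc.trans_le (h5.trans h6.le)) h7
      exact ⟨z, ⟨hz.1, h6.trans hz.2.1, hz.2.2⟩, hz.1, hz.2.1, hz.2.2.trans h8⟩
    · intro z hz
      rcases lt_or_ge z.im u' with h | h
      · exact Or.inl ⟨hz.1, hz.2.1, h⟩
      · exact Or.inr ⟨hz.1, h7.trans_le h, hz.2.2⟩
  · intro s t s' t' h5 h6 h7 h8 h9 hl hr
    refine (hl.union hp (isConvexOpen_rect _ _ _ _) (isConvexOpen_rect _ _ _ _) ?_ hr).mono ?_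
    · obtain ⟨z, hz⟩ := rect_nonempty h7 hc hcd
      exact ⟨z, ⟨⟨h6.trans hz.1.1, hz.1.2⟩, hz.2⟩, ⟨hz.1.1, hz.1.2.trans h8⟩, hz.2⟩
    · intro z hz
      rcases lt_or_ge z.re s' with h | h
      · exact Or.inl ⟨⟨hz.1.1, h⟩, hz.2⟩
      · exact Or.inr ⟨⟨h7.trans_le h, hz.1.2⟩, hz.2⟩

theorem hasLifts_univ (hp : IsOrbifoldCover p) : HasLifts p Set.univ := by
  classical
  intro w _ hwf x hx
  -- An exhaustion of `ℍ` by rectangles; from `n = 2` on, `1 / n < n` and they increase. Lifts with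
  -- the same value at `w` then agree on overlaps.
  let A : ℕ → Set ℍ := fun n => rect (-n) n (1 / n) n
  have hmono : ∀ m n, 2 ≤ m → m ≤ n → A m ⊆ A n := by
    intro m n hm hmn z hz
    have h1 : (m : ℝ) ≤ n := by exact_mod_cast hmn
    have h2 : (2 : ℝ) ≤ m := by exact_mod_cast hm
    have h3 : (1 / n : ℝ) ≤ 1 / m := one_div_le_one_div_of_le (by linarith) h1
    exact ⟨⟨by linarith [hz.1.1], by linarith [hz.1.2]⟩, by linarith [hz.2.1], by linarith [hz.2.2]⟩
  have hex : ∀ z : ℍ, ∃ n, 2 ≤ n ∧ z ∈ A n := by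
    intro z
    obtain ⟨n, hn⟩ := exists_nat_gt (max 2 (max |z.re| (max z.im (1 / z.im))))
    simp only [max_lt_iff] at hn
    obtain ⟨h1, h2, h3, h4⟩ := hn
    refine ⟨n, by exact_mod_cast h1.le, ⟨by linarith [(abs_lt.1 h2).1], (abs_lt.1 h2).2⟩, ?_, h3⟩
    rw [div_lt_comm₀ (by linarith) z.im_pos]
    exact h4
  have hlift : ∀ n, 2 ≤ n → HasLifts p (A n) := by
    intro n hn
    have h2 : (2 : ℝ) ≤ n := by exact_mod_cast hn
    refine hasLifts_rect hp (by linarith) (by positivity) ?_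
    rw [div_lt_iff₀ (by linarith)]
    nlinarith
  obtain ⟨N, hN, hwN⟩ := hex w
  have hwn : ∀ n, w ∈ A (n + N) := fun n => hmono N _ hN (by lia) hwN
  choose f hf hfw using fun n => hlift (n + N) (by lia) w (hwn n) hwf x hx
  have hex' : ∀ z : ℍ, ∃ n, z ∈ A (n + N) := by
    intro z
    obtain ⟨n, hn, hz⟩ := hex z
    exact ⟨n, hmono n _ hn (by lia) hz⟩
  have heq : ∀ m n, m ≤ n → Set.EqOn (f m) (f n) (A (m + N)) := fun m n hmn =>
    (hf m).eqOn hp (isConvexOpen_rect _ _ _ _) ((hf n).mono (hmono _ _ (by lia) (by lia))) (hwn m)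
      hwf ((hfw m).trans (hfw n).symm)
  have hq : ∀ n, Set.EqOn (fun z => f (hex' z).choose z) (f n) (A (n + N)) := by
    intro n z hz
    rcases le_total (hex' z).choose n with h | h
    · exact heq _ _ h (hex' z).choose_spec
    · exact (heq _ _ h hz).symm
  refine ⟨fun z => f (hex' z).choose z, ⟨?_, ?_⟩, ?_⟩
  · intro z _
    obtain ⟨n, hn⟩ := hex' z
    have hA : A (n + N) ∈ nhds z := (isConvexOpen_rect _ _ _ _).isOpen.mem_nhds hn
    exact (((hf n).continuousOn.congr (hq n)).continuousAt hA).continuousWithinAt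
  · intro z _
    exact (hf _).proj z (hex' z).choose_spec
  · exact (hq 0 (hwn 0)).trans (hfw 0)

/-! ## Covers as quotients of the upper half plane -/

variable {X : Type} [TopologicalSpace X] {p : X → Orb}

namespace IsLiftOn

variable {q : ℍ → X}

theorem isOpenMap (hp : IsOrbifoldCover p) (hq : IsLiftOn p q Set.univ) : IsOpenMap q := by
  intro O hO
  refine isOpen_iff_mem_nhds.2 ?_
  rintro _ ⟨z, hz, rfl⟩
  obtain ⟨c⟩ := hp.nonempty_ballChart z
  obtain ⟨i, γ, hγ, h⟩ := c.exists_eqOn hp (hq.mono (Set.subset_univ _))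
  have hO' : IsOpen (O ∩ Metric.ball z c.r) := hO.inter Metric.isOpen_ball
  have himage : q '' (O ∩ Metric.ball z c.r) =
      c.φ i '' ((γ • ·) '' (O ∩ Metric.ball z c.r)) := by
    rw [Set.image_image]
    exact Set.image_congr fun u hu => h hu.2
  have himage' : IsOpen (q '' (O ∩ Metric.ball z c.r)) := by
    rw [himage]
    refine c.isOpen_image i _ ?_ (isOpenMap_smul γ _ hO')
    rintro _ ⟨u, hu, rfl⟩
    exact smul_mem_ball hγ hu.2
  exact Filter.mem_of_superset (himage'.mem_nhds ⟨z, ⟨hz, c.mem_ball⟩, rfl⟩)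
    (Set.image_mono Set.inter_subset_left)

/-- The image is open; it is also closed, because once it meets a sheet it contains the centre of
that sheet: after a group translation the lift is `c.φ i` up to a rotation about the centre. -/
theorem surjective (hp : IsOrbifoldCover p) [PreconnectedSpace X] (hq : IsLiftOn p q Set.univ) :
    Function.Surjective q := by
  have h1 : IsOpen (Set.range q) := (hq.isOpenMap hp).isOpen_range
  have h2 : IsClosed (Set.range q) := by
    refine ⟨isOpen_iff_mem_nhds.2 fun x hx => ?_⟩
    obtain ⟨z, hz⟩ := surjective_toOrb (p x)
    obtain ⟨c⟩ := hp.nonempty_ballChart z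
    obtain ⟨i, hi⟩ := c.cover x z c.mem_ball hz.symm
    refine Filter.mem_of_superset ((c.isOpen_V i).mem_nhds hi) ?_
    rintro _ hy ⟨w, rfl⟩
    obtain ⟨u, hu, huw⟩ := c.surj i _ hy
    have h3 : toOrb w = toOrb u := by
      rw [← hq.proj w trivial, ← huw, (c.isLiftOn i).proj u hu]
    obtain ⟨γ, rfl⟩ := toOrb_eq_iff.1 h3
    obtain ⟨j, δ, hδ, h⟩ := c.exists_eqOn hp (hq.comp_smul γ fun _ _ => trivial)
    have hj : q (γ • u) ∈ c.V j := by
      have : q (γ • u) = c.φ j (δ • u) := h hu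
      rw [this]
      exact c.mapsTo j _ (smul_mem_ball hδ hu)
    obtain rfl := c.disjoint i j _ hy hj
    refine hx ⟨γ • z, ?_⟩
    have : q (γ • z) = c.φ i (δ • z) := h c.mem_ball
    rw [this, hδ, c.eq_center hi hz.symm]
  have h3 := IsClopen.eq_univ ⟨h2, h1⟩ ⟨q basePt, basePt, rfl⟩
  exact Set.range_eq_univ.1 h3

/-- If `q z = q (γ • z)`, then near `z` the lifts `q` and `q ∘ γ` are `c.φ i ∘ α` and `c.φ i ∘ β` in
the same sheet. So `γ * (β⁻¹ * α)` preserves `q` near `z`, hence everywhere by uniqueness, and it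
still sends `z` to `γ • z`. -/
theorem eq_iff (hp : IsOrbifoldCover p) (hq : IsLiftOn p q Set.univ) {z w : ℍ} :
    q z = q w ↔ ∃ γ : Modular, (∀ v, q (γ • v) = q v) ∧ γ • z = w := by
  refine ⟨fun h => ?_, ?_⟩
  · have h1 : toOrb w = toOrb z := by rw [← hq.proj z trivial, ← hq.proj w trivial, h]
    obtain ⟨γ, rfl⟩ := toOrb_eq_iff.1 h1
    obtain ⟨c⟩ := hp.nonempty_ballChart z
    obtain ⟨i, α, hα, hi⟩ := c.exists_eqOn hp (hq.mono (Set.subset_univ _))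
    obtain ⟨j, β, hβ, hj⟩ := c.exists_eqOn hp (hq.comp_smul γ fun _ _ => trivial)
    have hi' : ∀ v ∈ Metric.ball z c.r, q v = c.φ i (α • v) := hi
    have hj' : ∀ v ∈ Metric.ball z c.r, q (γ • v) = c.φ j (β • v) := hj
    have hij : i = j := by
      refine c.disjoint i j (q z) ?_ ?_
      · rw [hi' z c.mem_ball]
        exact c.mapsTo i _ (smul_mem_ball hα c.mem_ball)
      · rw [h, hj' z c.mem_ball]
        exact c.mapsTo j _ (smul_mem_ball hβ c.mem_ball)
    subst hij
    have hβ' : β⁻¹ • z = z := by rw [inv_smul_eq_iff, hβ]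
    have hk : (β⁻¹ * α) • z = z := by rw [mul_smul, hα, hβ']
    obtain ⟨v, hv, hvf⟩ := exists_mem_free Metric.isOpen_ball ⟨z, c.mem_ball⟩
    refine ⟨γ * (β⁻¹ * α), fun u => ?_, by rw [mul_smul, hk]⟩
    refine (hq.comp_smul (γ * (β⁻¹ * α)) fun _ _ => trivial).eqOn hp isConvexOpen_univ hq
      (Set.mem_univ v) hvf ?_ (Set.mem_univ u)
    rw [mul_smul, hj' _ (smul_mem_ball hk hv), hi' v hv, mul_smul, smul_inv_smul]
  · rintro ⟨γ, h, rfl⟩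
    exact (h z).symm

end IsLiftOn

/-- The sheets over a ball about `z` are indexed by the points `x` of the fibre over the image of
`z`. With `q (g x • z) = x`, the sheet is the image of `g x • ball`, and its local group consists of
the elements of the stabilizer of `z` which `g x` conjugates into `Γ`. -/
theorem isOrbifoldCover_of_quotient {q : ℍ → X} (Γ : Subgroup Modular) (hq : Continuous q)
    (hopen : IsOpenMap q) (hsurj : Function.Surjective q)
    (hfib : ∀ z w, q z = q w ↔ ∃ γ ∈ Γ, γ • z = w) (hproj : ∀ z, p (q z) = toOrb z) :
    IsOrbifoldCover p where
  continuous := by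
    rw [(hopen.isQuotientMap hq hsurj).continuous_iff]
    exact continuous_toOrb.congr fun z => (hproj z).symm
  chart z := by
    obtain ⟨r, hr, hst⟩ := exists_ball_stabilizer z
    have hex : ∀ x : {x : X // p x = toOrb z}, ∃ γ : Modular, q (γ • z) = x := by
      rintro ⟨x, hx⟩
      obtain ⟨w, rfl⟩ := hsurj x
      rw [hproj] at hx
      obtain ⟨γ, rfl⟩ := toOrb_eq_iff.1 hx
      exact ⟨γ, rfl⟩
    choose g hg using hex
    have hdiff : ∀ x y : {x : X // p x = toOrb z}, ∀ u ∈ Metric.ball z r, ∀ v ∈ Metric.ball z r,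
        ∀ δ ∈ Γ, δ • g x • u = g y • v → x = y := by
      intro x y u hu v hv δ hδ h
      rw [← inv_smul_eq_iff, smul_smul, smul_smul] at h
      have h1 := hst _ u hu (h.symm ▸ hv)
      refine Subtype.ext ?_
      rw [← hg x, ← hg y, hfib]
      refine ⟨δ, hδ, ?_⟩
      rw [mul_assoc, mul_smul, inv_smul_eq_iff, mul_smul] at h1
      exact h1
    refine ⟨Metric.ball z r, Metric.isOpen_ball, Metric.mem_ball_self hr,
      fun γ hγ u hu => smul_mem_ball hγ hu, fun γ u hu hγ => hst γ u hu hγ,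
      {x : X // p x = toOrb z}, fun x => Set.range fun u : Metric.ball z r => q (g x • (u : ℍ)),
      fun x => MulAction.stabilizer Modular z ⊓ Γ.comap (MulAut.conj (g x)).toMonoidHom,
      fun x u => q (g x • (u : ℍ)), ?_, ?_, ?_, fun x => ⟨inf_le_left, ?_, ?_, rfl, ?_, ?_⟩⟩
    · intro x
      have : (Set.range fun u : Metric.ball z r => q (g x • (u : ℍ))) =
          q '' ((g x • ·) '' Metric.ball z r) := by
        rw [Set.image_image]
        exact (Set.image_eq_range (fun u => q (g x • u)) (Metric.ball z r)).symm
      change IsOpen (Set.range fun u : Metric.ball z r => q (g x • (u : ℍ)))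
      rw [this]
      exact hopen _ (isOpenMap_smul (g x) _ Metric.isOpen_ball)
    · intro x y hxy
      rw [Set.disjoint_left]
      rintro _ ⟨⟨u, hu⟩, rfl⟩ ⟨⟨v, hv⟩, h⟩
      obtain ⟨δ, hδ, h⟩ := (hfib _ _).1 h.symm
      exact hxy (hdiff x y u hu v hv δ hδ h)
    · ext x
      constructor
      · intro hx
        obtain ⟨y, ⟨u, hu⟩, rfl⟩ := Set.mem_iUnion.1 hx
        exact ⟨u, hu, by rw [hproj, toOrb_smul]⟩
      · rintro ⟨u, hu, hux⟩
        obtain ⟨w, rfl⟩ := hsurj x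
        rw [hproj, eq_comm] at hux
        obtain ⟨γ, rfl⟩ := toOrb_eq_iff.1 hux
        let y : {x : X // p x = toOrb z} := ⟨q (γ • z), by rw [hproj, toOrb_smul]⟩
        obtain ⟨δ, hδ, h⟩ := (hfib _ _).1 (hg y)
        rw [← inv_smul_eq_iff, smul_smul, smul_smul] at h
        have hk : (γ⁻¹ * (δ * g y))⁻¹ • z = z := by
          rw [inv_smul_eq_iff, ← mul_assoc, h]
        refine Set.mem_iUnion.2 ⟨y, ⟨(γ⁻¹ * (δ * g y))⁻¹ • u, smul_mem_ball hk hu⟩, ?_⟩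
        refine (hfib _ _).2 ⟨δ, hδ, ?_⟩
        simp only [mul_inv_rev, mul_smul, inv_inv, smul_inv_smul]
    · exact hq.comp (continuous_subtype_val.const_smul (g x))
    · exact hopen.comp ((isOpenMap_smul (g x)).comp Metric.isOpen_ball.isOpenMap_subtype_val)
    · intro u
      rw [hproj, toOrb_smul]
    · intro u u'
      rw [hfib]
      constructor
      · rintro ⟨δ, hδ, h⟩
        have h' : ((g x)⁻¹ * δ * g x) • (u : ℍ) = u' := by
          rw [mul_smul, mul_smul, h, inv_smul_smul]
        refine ⟨(g x)⁻¹ * δ * g x, ⟨hst _ u u.2 (h'.symm ▸ u'.2), ?_⟩, h'⟩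
        simpa [mul_assoc] using hδ
      · rintro ⟨k, ⟨-, hk⟩, h⟩
        refine ⟨g x * k * (g x)⁻¹, hk, ?_⟩
        rw [← h]
        simp [mul_smul]

theorem isOrbifoldCover_toOrb : IsOrbifoldCover toOrb :=
  isOrbifoldCover_of_quotient (q := id) ⊥ continuous_id IsOpenMap.id Function.surjective_id
    (by simp) fun _ => rfl

/-! ### The pointed universal cover and the correspondence between covers and subgroups. -/

namespace PointedCover

theorem isLift_iff {X : PointedCover} {q : ℍ → X.carrier} :
    X.IsLift q ↔ IsLiftOn X.proj q Set.univ :=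
  ⟨fun h => ⟨h.1.continuousOn, fun z _ => h.2 z⟩,
    fun h => ⟨continuousOn_univ.1 h.1, fun z => h.2 z trivial⟩⟩

theorem IsLift.eq_of_eq {X : PointedCover} {q q' : ℍ → X.carrier} (h : X.IsLift q)
    (h' : X.IsLift q') {z : ℍ} (hz : z ∈ free) (hqq : q z = q' z) : q = q' :=
  funext fun w => (isLift_iff.1 h).eqOn X.isCover isConvexOpen_univ (isLift_iff.1 h')
    (Set.mem_univ z) hz hqq (Set.mem_univ w)

theorem IsLift.smul {X : PointedCover} {q : ℍ → X.carrier} (h : X.IsLift q) (γ : Modular) :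
    X.IsLift fun z => q (γ • z) :=
  isLift_iff.2 ((isLift_iff.1 h).comp_smul γ fun _ _ => trivial)

theorem existsUnique_lift (X : PointedCover) :
    ∃! q : ℍ → X.carrier, X.IsLift q ∧ q basePt = X.base := by
  obtain ⟨q, hq, hb⟩ := hasLifts_univ X.isCover basePt trivial basePt_mem_free X.base X.proj_base
  exact ⟨q, ⟨isLift_iff.2 hq, hb⟩, fun q' h' =>
    h'.1.eq_of_eq (isLift_iff.2 hq) basePt_mem_free (h'.2.trans hb.symm)⟩

/-- The pointed universal cover `(ℍ, basePt) → (X, base)`. -/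
def univ (X : PointedCover) : ℍ → X.carrier := X.existsUnique_lift.choose

variable (X : PointedCover)

theorem isLift_univ : X.IsLift X.univ := X.existsUnique_lift.choose_spec.1.1

theorem univ_basePt : X.univ basePt = X.base := X.existsUnique_lift.choose_spec.1.2

variable {X}

theorem eq_univ {q : ℍ → X.carrier} (h : X.IsLift q) (hb : q basePt = X.base) : q = X.univ :=
  X.existsUnique_lift.choose_spec.2 q ⟨h, hb⟩

variable (X)

theorem continuous_univ : Continuous X.univ := X.isLift_univ.1

theorem proj_univ (z : ℍ) : X.proj (X.univ z) = toOrb z := X.isLift_univ.2 z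

theorem isOpenMap_univ : IsOpenMap X.univ := (isLift_iff.1 X.isLift_univ).isOpenMap X.isCover

theorem surjective_univ : Function.Surjective X.univ :=
  (isLift_iff.1 X.isLift_univ).surjective X.isCover

theorem isOpenQuotientMap_univ : IsOpenQuotientMap X.univ :=
  ⟨X.surjective_univ, X.continuous_univ, X.isOpenMap_univ⟩

variable {X}

theorem mem_fundamentalGroup {γ : Modular} :
    γ ∈ X.fundamentalGroup ↔ ∀ z, X.univ (γ • z) = X.univ z :=
  ⟨fun h => h X.univ X.isLift_univ X.univ_basePt, fun h q h1 h2 => by rwa [eq_univ h1 h2]⟩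

theorem univ_eq_iff {z w : ℍ} :
    X.univ z = X.univ w ↔ ∃ γ ∈ X.fundamentalGroup, γ • z = w := by
  rw [(isLift_iff.1 X.isLift_univ).eq_iff X.isCover]
  simp only [mem_fundamentalGroup]

theorem univ_eq_iff_of_mem_free {z : ℍ} (hz : z ∈ free) {γ δ : Modular} :
    X.univ (γ • z) = X.univ (δ • z) ↔ δ * γ⁻¹ ∈ X.fundamentalGroup := by
  rw [univ_eq_iff]
  constructor
  · rintro ⟨α, hα, h⟩
    have : δ⁻¹ * (α * γ) = 1 := hz _ (by rw [mul_smul, mul_smul, h, inv_smul_smul])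
    rw [inv_mul_eq_one] at this
    rwa [this, mul_inv_cancel_right]
  · intro h
    exact ⟨_, h, by rw [mul_smul, inv_smul_smul]⟩

theorem exists_smul_of_isLift {q : ℍ → X.carrier} (hq : X.IsLift q) :
    ∃ γ : Modular, ∀ z, q z = X.univ (γ • z) := by
  obtain ⟨w, hw⟩ := X.surjective_univ (q basePt)
  have h : toOrb w = toOrb basePt := by rw [← X.proj_univ, hw, hq.2]
  obtain ⟨γ, rfl⟩ := toOrb_eq_iff.1 h
  exact ⟨γ, congrFun (hq.eq_of_eq (X.isLift_univ.smul γ) basePt_mem_free hw.symm)⟩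

/-- The composite is again a pointed lift, hence the universal one. As universal maps are onto, this
determines every arrow, so the category is thin. -/
theorem covering_univ {X Y : PointedCover} (f : X ⟶ Y) (z : ℍ) :
    covering f (Y.univ z) = X.univ z := by
  have h : X.IsLift fun z => covering f (Y.univ z) :=
    ⟨(CoveringMap.continuous_toFun f).comp Y.continuous_univ,
      fun z => (CoveringMap.proj_comp f _).trans (Y.proj_univ z)⟩
  refine congrFun (eq_univ h ?_) z
  rw [univ_basePt]
  exact CoveringMap.map_base f

instance (X Y : PointedCover) : Subsingleton (X ⟶ Y) where
  allEq f g := by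
    refine CoveringMap.ext (funext fun y => ?_)
    obtain ⟨z, rfl⟩ := Y.surjective_univ y
    exact (covering_univ f z).trans (covering_univ g z).symm

theorem fundamentalGroup_le {X Y : PointedCover} (f : X ⟶ Y) :
    Y.fundamentalGroup ≤ X.fundamentalGroup := by
  intro γ hγ
  rw [mem_fundamentalGroup] at hγ ⊢
  intro z
  rw [← covering_univ f, hγ, covering_univ]

/-- The universal map of `X` is constant on the fibres of that of `Y`, so it factors through this
quotient map. -/
theorem nonempty_hom {X Y : PointedCover} (h : Y.fundamentalGroup ≤ X.fundamentalGroup) :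
    Nonempty (X ⟶ Y) := by
  have key : ∀ z, X.univ (Function.surjInv Y.surjective_univ (Y.univ z)) = X.univ z := by
    intro z
    obtain ⟨γ, hγ, h1⟩ := univ_eq_iff.1 (Function.surjInv_eq Y.surjective_univ (Y.univ z))
    exact univ_eq_iff.2 ⟨γ, h hγ, h1⟩
  refine ⟨(⟨fun y => X.univ (Function.surjInv Y.surjective_univ y), ?_, fun y => ?_, ?_⟩ :
    CoveringMap Y X)⟩
  · rw [Y.isOpenQuotientMap_univ.isQuotientMap.continuous_iff]
    exact X.continuous_univ.congr fun z => (key z).symm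
  · rw [proj_univ, ← Y.proj_univ, Function.surjInv_eq Y.surjective_univ]
  · rw [← univ_basePt, key, univ_basePt]

instance (Γ : Subgroup Modular) : ContinuousConstSMul Γ ℍ :=
  ⟨fun γ => continuous_const_smul (γ : Modular)⟩

/-- The cover `Γ \ ℍ`. -/
def ofSubgroup (Γ : Subgroup Modular) : PointedCover where
  carrier := MulAction.orbitRel.Quotient Γ ℍ
  conn := Quotient.mk_surjective.connectedSpace continuous_quotient_mk'
  proj := Quotient.lift toOrb fun z w h => by
    obtain ⟨γ, rfl⟩ := MulAction.orbitRel_apply.1 h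
    exact toOrb_smul (γ : Modular) w
  isCover := isOrbifoldCover_of_quotient (q := Quotient.mk _) Γ continuous_quotient_mk'
    isOpenMap_quotient_mk'_mul Quotient.mk_surjective (fun z w => by
      rw [eq_comm, Quotient.eq, MulAction.orbitRel_apply, MulAction.mem_orbit_iff]
      exact ⟨fun ⟨γ, h⟩ => ⟨γ, γ.2, h⟩, fun ⟨γ, hγ, h⟩ => ⟨⟨γ, hγ⟩, h⟩⟩) fun _ => rfl
  base := Quotient.mk _ basePt
  proj_base := rfl

theorem fundamentalGroup_ofSubgroup (Γ : Subgroup Modular) :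
    (ofSubgroup Γ).fundamentalGroup = Γ := by
  let q : ℍ → (ofSubgroup Γ).carrier := Quotient.mk (MulAction.orbitRel Γ ℍ)
  have h : q = (ofSubgroup Γ).univ := eq_univ ⟨continuous_quotient_mk', fun _ => rfl⟩ rfl
  have hmk : ∀ z w : ℍ, (ofSubgroup Γ).univ z = (ofSubgroup Γ).univ w ↔
      ∃ γ : Γ, (γ : Modular) • w = z := by
    intro z w
    rw [← h]
    exact Quotient.eq
  ext γ
  rw [mem_fundamentalGroup]
  constructor
  · intro hγ
    obtain ⟨δ, hδ⟩ := (hmk _ _).1 (hγ basePt)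
    have : γ⁻¹ * δ = 1 := basePt_mem_free _ (by rw [mul_smul, hδ, inv_smul_smul])
    rw [inv_mul_eq_one.1 this]
    exact δ.2
  · exact fun hγ z => (hmk _ _).2 ⟨⟨γ, hγ⟩, rfl⟩

theorem isFinite_iff : PointedCover.IsFinite X ↔ X.fundamentalGroup.FiniteIndex := by
  -- Inverses turn the left cosets `a Γ` into the points `a⁻¹ • z` modulo the left action of `Γ`.
  have hlift : ∀ z : ℍ, ∀ a b : Modular, a⁻¹ * b ∈ X.fundamentalGroup →
      X.univ (a⁻¹ • z) = X.univ (b⁻¹ • z) := fun z a b h =>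
    univ_eq_iff.2 ⟨(a⁻¹ * b)⁻¹, inv_mem h, by rw [smul_smul]; congr 1; group⟩
  constructor
  · intro h
    -- The fibre over the base point suffices: the base point is free, so distinct cosets give
    -- distinct points of this fibre.
    have hfin : Finite (X.proj ⁻¹' {toOrb basePt}) := h (toOrb basePt)
    let f : Modular ⧸ X.fundamentalGroup → X.proj ⁻¹' {toOrb basePt} :=
      Quotient.lift (fun a => ⟨X.univ (a⁻¹ • basePt), by simp [proj_univ]⟩) fun a b hab =>
        Subtype.ext (hlift basePt a b (QuotientGroup.leftRel_apply.1 hab))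
    have hf : Function.Injective f := by
      intro a b
      induction a using Quotient.inductionOn with | h a => ?_
      induction b using Quotient.inductionOn with | h b => ?_
      intro hab
      have h1 : X.univ (a⁻¹ • basePt) = X.univ (b⁻¹ • basePt) := congrArg Subtype.val hab
      rw [univ_eq_iff_of_mem_free basePt_mem_free, inv_inv] at h1
      refine Quotient.sound (QuotientGroup.leftRel_apply.2 ?_)
      simpa using inv_mem h1
    have := Finite.of_injective f hf
    exact Subgroup.finiteIndex_of_finite_quotient
  · intro h m
    obtain ⟨z, rfl⟩ := surjective_toOrb m
    let f : Modular ⧸ X.fundamentalGroup → X.carrier :=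
      Quotient.lift (fun a => X.univ (a⁻¹ • z)) fun a b hab =>
        hlift z a b (QuotientGroup.leftRel_apply.1 hab)
    refine (Set.finite_range f).subset fun x hx => ?_
    obtain ⟨w, rfl⟩ := X.surjective_univ x
    obtain ⟨γ, rfl⟩ := toOrb_eq_iff.1 ((X.proj_univ w).symm.trans hx)
    exact ⟨QuotientGroup.mk γ⁻¹, congrArg (fun δ : Modular => X.univ (δ • z)) (inv_inv γ)⟩

/-- The fundamental group functor. -/
def fundamentalGroupFunctor : PointedCoverᵒᵖ ⥤ Sub where
  obj X := X.unop.fundamentalGroup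
  map f := homOfLE (fundamentalGroup_le f.unop)

instance : fundamentalGroupFunctor.Faithful where
  map_injective _ := Quiver.Hom.unop_inj (Subsingleton.elim _ _)

instance : fundamentalGroupFunctor.Full where
  map_surjective f := ⟨(nonempty_hom (leOfHom f)).some.op, Subsingleton.elim _ _⟩

instance : fundamentalGroupFunctor.EssSurj where
  mem_essImage Γ := ⟨Opposite.op (ofSubgroup Γ), ⟨eqToIso (fundamentalGroup_ofSubgroup Γ)⟩⟩

instance : fundamentalGroupFunctor.IsEquivalence where

end PointedCover

/-- `ℍ` as a pointed cover. -/
def upperHalfPlaneCover : PointedCover where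
  carrier := ℍ
  conn := inferInstance
  proj := toOrb
  isCover := isOrbifoldCover_toOrb
  base := basePt
  proj_base := rfl

theorem existsUnique_smul (φ : ℍ → ℍ) (hφ : Continuous φ) (h : ∀ z, toOrb (φ z) = toOrb z) :
    ∃! γ : Modular, ∀ z, φ z = γ • z := by
  have hid : upperHalfPlaneCover.univ = (id : ℍ → ℍ) :=
    (PointedCover.eq_univ (X := upperHalfPlaneCover) ⟨continuous_id, fun _ => rfl⟩ rfl).symm
  obtain ⟨γ, hγ⟩ := PointedCover.exists_smul_of_isLift (X := upperHalfPlaneCover) (q := φ) ⟨hφ, h⟩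
  rw [hid] at hγ
  refine ⟨γ, hγ, fun δ hδ => ?_⟩
  have h1 : γ • basePt = δ • basePt := (hγ basePt).symm.trans (hδ basePt)
  have h2 : γ⁻¹ * δ = 1 := basePt_mem_free _ (by rw [mul_smul, ← h1, inv_smul_smul])
  exact (inv_mul_eq_one.1 h2).symm

/-! ## The modular group as a free product -/

theorem S_smul_re_eq (z : ℍ) : (S • z).re = -z.re / Complex.normSq z := by
  rw [S, mk_smul, UpperHalfPlane.modular_S_smul, UpperHalfPlane.mk_re, Complex.inv_re,
    Complex.normSq_neg]
  simp

theorem S_smul_re_neg {z : ℍ} (hz : 0 < z.re) : (S • z).re < 0 := by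
  rw [S_smul_re_eq]
  exact div_neg_of_neg_of_pos (neg_neg_of_pos hz) z.normSq_pos

theorem S_smul_re_pos {z : ℍ} (hz : z.re < 0) : 0 < (S • z).re := by
  rw [S_smul_re_eq]
  exact div_pos (neg_pos.2 hz) z.normSq_pos

theorem S_sq : S ^ 2 = 1 := (pow_two S).trans S_mul_S

theorem L_cube : L ^ 3 = 1 := (pow_succ' L 2).trans L_mul_L_sq

theorem L_sq_eq_inv : L ^ 2 = L⁻¹ := eq_inv_of_mul_eq_one_right L_mul_L_sq

theorem S_inv : S⁻¹ = S := (eq_inv_of_mul_eq_one_left S_mul_S).symm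

theorem L_smul_re_pos {z : ℍ} (hz : z.re < 0) : 0 < (L • z).re := by
  rw [L_eq, mul_smul, T_smul_re]
  linarith [S_smul_re_pos hz]

theorem L_sq_smul_re_pos {z : ℍ} (hz : z.re < 0) : 0 < (L ^ 2 • z).re := by
  rw [L_sq_eq, mul_smul]
  refine S_smul_re_pos ?_
  rw [T_inv_smul_re]
  linarith

theorem exists_re_neg : ∃ z : ℍ, z.re < 0 := ⟨⟨⟨-1, 1⟩, one_pos⟩, neg_one_lt_zero⟩

theorem orderOf_S : orderOf S = 2 := by
  have : Fact (Nat.Prime 2) := ⟨Nat.prime_two⟩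
  refine orderOf_eq_prime S_sq fun h => ?_
  obtain ⟨z, hz⟩ := exists_re_neg
  have := S_smul_re_pos hz
  rw [h, one_smul] at this
  exact this.not_gt hz

theorem orderOf_L : orderOf L = 3 := by
  have : Fact (Nat.Prime 3) := ⟨Nat.prime_three⟩
  refine orderOf_eq_prime L_cube fun h => ?_
  obtain ⟨z, hz⟩ := exists_re_neg
  have := L_smul_re_pos hz
  rw [h, one_smul] at this
  exact this.not_gt hz

theorem eq_of_mem_zpowers_S {γ : Modular} (h : γ ∈ Subgroup.zpowers S) : γ = 1 ∨ γ = S := by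
  classical
  have hfin : IsOfFinOrder S := orderOf_pos_iff.1 (by rw [orderOf_S]; norm_num)
  rw [hfin.mem_zpowers_iff_mem_range_orderOf, orderOf_S] at h
  obtain ⟨n, hn, rfl⟩ := Finset.mem_image.1 h
  rw [Finset.mem_range] at hn
  interval_cases n <;> simp

theorem eq_of_mem_zpowers_L {γ : Modular} (h : γ ∈ Subgroup.zpowers L) :
    γ = 1 ∨ γ = L ∨ γ = L ^ 2 := by
  classical
  have hfin : IsOfFinOrder L := orderOf_pos_iff.1 (by rw [orderOf_L]; norm_num)
  rw [hfin.mem_zpowers_iff_mem_range_orderOf, orderOf_L] at h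
  obtain ⟨n, hn, rfl⟩ := Finset.mem_image.1 h
  rw [Finset.mem_range] at hn
  interval_cases n <;> simp

theorem closure_S_L : Subgroup.closure {S, L} = ⊤ := by
  refine eq_top_iff.2 fun γ _ => ?_
  induction γ using induction_modular with | h g => ?_
  have hS : S ∈ Subgroup.closure {S, L} := Subgroup.subset_closure (Or.inl rfl)
  have hL : L ∈ Subgroup.closure {S, L} := Subgroup.subset_closure (Or.inr rfl)
  have hT : T ∈ Subgroup.closure {S, L} := by
    have : T = L * S := by rw [L_eq, mul_assoc, S_mul_S, mul_one]
    rw [this]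
    exact mul_mem hL hS
  have h : Subgroup.closure {ModularGroup.S, ModularGroup.T} ≤
      (Subgroup.closure {S, L}).comap (QuotientGroup.mk' (Subgroup.center SL(2, ℤ))) := by
    rw [Subgroup.closure_le]
    rintro _ (rfl | rfl)
    · exact hS
    · exact hT
  rw [SpecialLinearGroup.SL2Z_generators] at h
  exact h (Subgroup.mem_top g)

/-- The factors of the free product. -/
abbrev Factor (b : Bool) : Subgroup Modular := Subgroup.zpowers (cond b S L)

/-- The homomorphism from the free product of the cyclic groups generated by `S` and `L`. -/
def ofFreeProduct : Monoid.CoprodI (fun b => Factor b) →* Modular :=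
  Monoid.CoprodI.lift fun b => (Factor b).subtype

open scoped Pointwise in
-- Ping-pong on the two halves of `ℍ`: `S` sends `re > 0` into `re < 0`, while `L` and `L ^ 2` send
-- `re < 0` into `re > 0`.
theorem ofFreeProduct_injective : Function.Injective ofFreeProduct := by
  refine Monoid.CoprodI.lift_injective_of_ping_pong (fun b => (Factor b).subtype)
    (Or.inr ⟨false, ?_⟩) (fun b => cond b {z : ℍ | z.re < 0} {z : ℍ | 0 < z.re}) ?_ ?_ ?_
  -- With only two factors, ping-pong needs one of them to have at least three elements.
  · have h : Nat.card (Factor false) = 3 := (Nat.card_zpowers L).trans orderOf_L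
    have : Finite (Factor false) := Nat.finite_of_card_ne_zero (by rw [h]; norm_num)
    rw [← Nat.cast_card, h]
    norm_num
  · rintro (_ | _)
    · obtain ⟨z, hz⟩ := exists_re_neg
      exact ⟨S • z, S_smul_re_pos hz⟩
    · exact exists_re_neg
  · rintro (_ | _) (_ | _) h
    · exact absurd rfl h
    · exact Set.disjoint_left.2 fun z (hz : 0 < z.re) (hz' : z.re < 0) => hz.not_gt hz'
    · exact Set.disjoint_left.2 fun z (hz : z.re < 0) (hz' : 0 < z.re) => hz.not_gt hz'
    · exact absurd rfl h
  · rintro (_ | _) (_ | _) h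
    · exact absurd rfl h
    · rintro ⟨γ, hγ⟩ hne _ ⟨z, hz, rfl⟩
      rcases eq_of_mem_zpowers_L hγ with rfl | rfl | rfl
      · exact absurd rfl hne
      · exact L_smul_re_pos hz
      · exact L_sq_smul_re_pos hz
    · rintro ⟨γ, hγ⟩ hne _ ⟨z, hz, rfl⟩
      rcases eq_of_mem_zpowers_S hγ with rfl | rfl
      · exact absurd rfl hne
      · exact S_smul_re_neg hz
    · exact absurd rfl h

/-- The generator of a factor. -/
def Factor.gen (b : Bool) : Factor b := ⟨cond b S L, Subgroup.mem_zpowers _⟩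

theorem ofFreeProduct_gen (b : Bool) :
    ofFreeProduct (Monoid.CoprodI.of (Factor.gen b)) = cond b S L :=
  Monoid.CoprodI.lift_of _ _

theorem ofFreeProduct_surjective : Function.Surjective ofFreeProduct := by
  rw [← MonoidHom.range_eq_top, eq_top_iff, ← closure_S_L, Subgroup.closure_le]
  rintro _ (rfl | rfl)
  · exact ⟨_, ofFreeProduct_gen true⟩
  · exact ⟨_, ofFreeProduct_gen false⟩

theorem exists_monoidHom {K : Type*} [Group K] (s l : K) (hs : s ^ 2 = 1) (hl : l ^ 3 = 1) :
    ∃ π : Modular →* K, π S = s ∧ π L = l := by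
  have hgen : ∀ b, ∀ x : Factor b, x ∈ Subgroup.zpowers (Factor.gen b) := by
    rintro b ⟨_, n, rfl⟩
    exact ⟨n, Subtype.ext rfl⟩
  have horder : ∀ b, orderOf (cond b s l) ∣ orderOf (Factor.gen b) := by
    intro b
    rw [← Subgroup.orderOf_coe]
    cases b
    · exact (orderOf_dvd_of_pow_eq_one hl).trans orderOf_L.symm.dvd
    · exact (orderOf_dvd_of_pow_eq_one hs).trans orderOf_S.symm.dvd
  let e : Monoid.CoprodI (fun b => Factor b) ≃* Modular :=
    MulEquiv.ofBijective ofFreeProduct ⟨ofFreeProduct_injective, ofFreeProduct_surjective⟩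
  let ψ : Monoid.CoprodI (fun b => Factor b) →* K :=
    Monoid.CoprodI.lift (M := fun b => Factor b) fun b =>
      monoidHomOfForallMemZpowers (hgen b) (horder b)
  have key : ∀ b, ψ (e.symm (cond b S L)) = cond b s l := by
    intro b
    have : e.symm (cond b S L) =
        Monoid.CoprodI.of (M := fun b => Factor b) (Factor.gen b) := by
      rw [MulEquiv.symm_apply_eq]
      exact (ofFreeProduct_gen b).symm
    rw [this]
    exact (Monoid.CoprodI.lift_of (M := fun b => Factor b) _ _).trans
      (monoidHomOfForallMemZpowers_apply_gen (hgen b) (horder b))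
  exact ⟨ψ.comp e.symm.toMonoidHom, key true, key false⟩

/-! ## Modular graphs as transitive actions -/

theorem induction_generators {P : Modular → Prop} (one : P 1) (hS : P S) (hL : P L)
    (mul : ∀ a b, P a → P b → P (a * b)) (inv : ∀ a, P a → P a⁻¹) (γ : Modular) : P γ := by
  have h : γ ∈ Subgroup.closure {S, L} := by rw [closure_S_L]; trivial
  induction h using Subgroup.closure_induction with
  | mem x hx =>
    rcases hx with rfl | rfl
    · exact hS
    · exact hL
  | one => exact one
  | mul x y _ _ hx hy => exact mul x y hx hy
  | inv x _ hx => exact inv x hx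

theorem ncard_orbit_zpowers {G α : Type*} [Group G] [MulAction G α] (g : G) (a : α) :
    (MulAction.orbit (Subgroup.zpowers g) a).ncard = Function.minimalPeriod (g • ·) a := by
  rw [← Nat.card_coe_set_eq, Nat.card_congr (MulAction.orbitZPowersEquiv g a), Nat.card_zmod]

theorem ncard_orbit_zpowers_eq {G α : Type*} [Group G] [MulAction G α] {g : G} {n : ℕ}
    (hn : n.Prime) (hg : g ^ n = 1) (a : α) :
    (MulAction.orbit (Subgroup.zpowers g) a).ncard = 1 ∨
      (MulAction.orbit (Subgroup.zpowers g) a).ncard = n := by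
  rw [ncard_orbit_zpowers, ← Nat.dvd_prime hn]
  refine Function.IsPeriodicPt.minimalPeriod_dvd ?_
  rw [Function.IsPeriodicPt, Function.IsFixedPt, smul_iterate_apply, hg, one_smul]

theorem mem_orbit_zpowers_iff {G α : Type*} [Group G] [MulAction G α] {g : G} {a b : α} :
    b ∈ MulAction.orbit (Subgroup.zpowers g) a ↔ ∃ n : ℤ, g ^ n • a = b := by
  constructor
  · rintro ⟨⟨_, n, rfl⟩, rfl⟩
    exact ⟨n, rfl⟩
  · rintro ⟨n, rfl⟩
    exact ⟨⟨_, n, rfl⟩, rfl⟩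

namespace ModularGraph

variable (G : ModularGraph)

/-- The cycle through an edge is the fibre at its `•`-vertex, so its length divides `3`. -/
theorem next_pow_three : G.next ^ 3 = 1 := by
  ext e
  have hfib : G.black ⁻¹' {G.black e} = MulAction.orbit (Subgroup.zpowers G.next) e := by
    ext d
    rw [mem_orbit_zpowers_iff, Set.mem_preimage, Set.mem_singleton_iff, eq_comm, G.next_cyclic]
    rfl
  have h := G.black_degree (G.black e)
  rw [hfib, ncard_orbit_zpowers, ← Nat.dvd_prime Nat.prime_three] at h
  have h1 := (Function.isPeriodicPt_minimalPeriod (G.next • ·) e).trans_dvd h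
  rwa [Function.IsPeriodicPt, Function.IsFixedPt, smul_iterate_apply] at h1

theorem existsUnique_across (e : G.Edge) : ∃! d, G.Across e d := by
  rcases G.white_degree (G.white e) with h | h
  · obtain ⟨a, ha⟩ := Set.ncard_eq_one.1 h
    have hmem : ∀ d, G.white d = G.white e ↔ d = a := fun d => by
      rw [← Set.mem_singleton_iff (b := a), ← ha]; rfl
    have hea := (hmem e).1 rfl
    exact ⟨e, ⟨rfl, fun _ d hd => ((hmem d).1 hd).trans hea.symm⟩,
      fun d hd => ((hmem d).1 hd.1.symm).trans hea.symm⟩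
  · obtain ⟨a, b, hab, heq⟩ := Set.ncard_eq_two.1 h
    have hmem : ∀ d, G.white d = G.white e ↔ d = a ∨ d = b := fun d => by
      rw [← Set.mem_singleton_iff (b := b), ← Set.mem_insert_iff, ← heq]; rfl
    have key : ∀ a b : G.Edge, a ≠ b → (∀ d, G.white d = G.white e ↔ d = a ∨ d = b) → e = a →
        ∃! d, G.Across e d := by
      rintro a b hab hmem rfl
      refine ⟨b, ⟨((hmem b).2 (Or.inr rfl)).symm, fun h => absurd h hab⟩, fun d hd => ?_⟩
      rcases (hmem d).1 hd.1.symm with rfl | h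
      · exact absurd (hd.2 rfl b ((hmem b).2 (Or.inr rfl))) hab.symm
      · exact h
    rcases (hmem e).1 rfl with h1 | h1
    · exact key a b hab hmem h1
    · exact key b a hab.symm (fun d => (hmem d).trans or_comm) h1

theorem Across.eq {G : ModularGraph} {a b c : G.Edge} (h : G.Across a b) (h' : G.Across a c) :
    b = c :=
  (G.existsUnique_across a).unique h h'

/-- The permutation which takes an edge to the other edge at its `∘`-vertex. -/
def acrossPerm : Equiv.Perm G.Edge where
  toFun e := (G.existsUnique_across e).choose
  invFun e := (G.existsUnique_across e).choose
  left_inv e := (G.existsUnique_across _).choose_spec.1.eq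
    (G.existsUnique_across e).choose_spec.1.symm
  right_inv e := (G.existsUnique_across _).choose_spec.1.eq
    (G.existsUnique_across e).choose_spec.1.symm

theorem across_acrossPerm (e : G.Edge) : G.Across e (G.acrossPerm e) :=
  (G.existsUnique_across e).choose_spec.1

theorem acrossPerm_sq : G.acrossPerm ^ 2 = 1 := by
  ext e
  exact G.acrossPerm.left_inv e

/-- The inverse of `next` appears because words of walks grow on the right while the action is on
the left: reading `L` must act through `L⁻¹` as `next`. -/
theorem exists_action : ∃ π : Modular →* Equiv.Perm G.Edge, π S = G.acrossPerm ∧ π L = G.next⁻¹ :=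
  exists_monoidHom _ _ G.acrossPerm_sq (by rw [inv_pow, G.next_pow_three, inv_one])

/-- The action of the modular group on edges for which `S` passes the `∘`-vertex, and `L` continues
with the right edge at the `•`-vertex. -/
instance : MulAction Modular G.Edge := MulAction.compHom G.Edge G.exists_action.choose

theorem S_smul (e : G.Edge) : S • e = G.acrossPerm e := by
  change G.exists_action.choose S e = _
  rw [G.exists_action.choose_spec.1]

theorem L_smul (e : G.Edge) : L • e = G.next.symm e := by
  change G.exists_action.choose L e = _
  rw [G.exists_action.choose_spec.2]
  rfl

theorem across_iff {a b : G.Edge} : G.Across a b ↔ S • a = b := by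
  rw [S_smul]
  exact ⟨fun h => (G.across_acrossPerm a).eq h, fun h => h ▸ G.across_acrossPerm a⟩

theorem L_inv_smul (e : G.Edge) : L⁻¹ • e = G.next e := by
  rw [inv_smul_eq_iff, L_smul, Equiv.symm_apply_apply]

/-- This translates walks into the action, so that closed walks at the base edge give its
stabilizer. The converse direction builds walks from the generators by concatenation and reversal.
-/
theorem walk_iff {W : Modular} {a b : G.Edge} : G.Walk a W b ↔ W⁻¹ • a = b := by
  constructor
  · intro h
    induction h with
    | nil => rw [inv_one, one_smul]
    | across _ hx ih => rw [mul_inv_rev, mul_smul, ih, S_inv, G.across_iff.1 hx]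
    | left _ ih => rw [mul_inv_rev, mul_smul, ih, L_inv_smul]
    | right _ ih => rw [mul_inv_rev, mul_smul, ih, L_sq_eq_inv, inv_inv, L_smul]
  · suffices h : ∀ a, G.Walk a W (W⁻¹ • a) from fun hb => hb ▸ h a
    induction W using induction_generators with
    | one => exact fun a => by rw [inv_one, one_smul]; exact Walk.nil
    | hS =>
      intro a
      have := Walk.nil.across (G.across_iff.2 (rfl : S • a = S • a))
      rw [one_mul] at this
      rwa [S_inv]
    | hL =>
      intro a
      have := (Walk.nil (G := G) (e := a)).left
      rwa [one_mul, ← L_inv_smul] at this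
    | mul x y hx hy =>
      intro a
      rw [mul_inv_rev, mul_smul]
      exact (hx a).trans (hy _)
    | inv x hx =>
      intro a
      have := (hx (x • a)).symm
      rwa [inv_smul_smul, ← inv_inv x, inv_inv x⁻¹] at this

theorem white_eq_iff {a b : G.Edge} : G.white a = G.white b ↔ b = a ∨ b = S • a := by
  constructor
  · intro h
    by_cases hab : a = b
    · exact Or.inl hab.symm
    · exact Or.inr (G.across_iff.1 ⟨h, fun h' => absurd h' hab⟩).symm
  · rintro (rfl | rfl)
    · rfl
    · exact (G.across_iff.2 rfl).1

theorem black_eq_iff {a b : G.Edge} : G.black a = G.black b ↔ ∃ n : ℤ, L ^ n • a = b := by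
  have key : ∀ n : ℤ, (G.next ^ n) a = L ^ (-n) • a := by
    intro n
    change _ = (G.exists_action.choose (L ^ (-n))) a
    rw [map_zpow, G.exists_action.choose_spec.2, inv_zpow', neg_neg]
  rw [G.next_cyclic]
  constructor
  · rintro ⟨n, hn⟩
    exact ⟨-n, (key n).symm.trans hn⟩
  · rintro ⟨n, hn⟩
    exact ⟨-n, (key (-n)).trans (by rwa [neg_neg])⟩

theorem exists_smul_eq (a b : G.Edge) : ∃ W : Modular, W • a = b := by
  induction G.connected a b with
  | refl => exact ⟨1, one_smul _ _⟩
  | tail _ h ih =>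
    obtain ⟨W, rfl⟩ := ih
    rcases h with h | h
    · rcases G.white_eq_iff.1 h with rfl | rfl
      · exact ⟨W, rfl⟩
      · exact ⟨S * W, mul_smul _ _ _⟩
    · obtain ⟨n, rfl⟩ := G.black_eq_iff.1 h
      exact ⟨L ^ n * W, mul_smul _ _ _⟩

theorem surjective_white : Function.Surjective G.white := fun v => by
  by_contra h
  have : G.white ⁻¹' {v} = ∅ := Set.eq_empty_of_forall_notMem fun e he => h ⟨e, he⟩
  have hd := G.white_degree v
  rw [this, Set.ncard_empty] at hd
  lia

theorem surjective_black : Function.Surjective G.black := fun v => by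
  by_contra h
  have : G.black ⁻¹' {v} = ∅ := Set.eq_empty_of_forall_notMem fun e he => h ⟨e, he⟩
  have hd := G.black_degree v
  rw [this, Set.ncard_empty] at hd
  lia

end ModularGraph

/-! ### Pointed graphs, coset graphs and subgroups. -/

namespace PointedModularGraph

variable {G H : PointedModularGraph}

theorem mem_fundamentalGroup {W : Modular} : W ∈ G.fundamentalGroup ↔ W • G.base = G.base := by
  change G.Walk G.base W G.base ↔ _
  rw [G.walk_iff, inv_smul_eq_iff, eq_comm]

theorem smul_base_eq_iff {a b : Modular} :
    a • G.base = b • G.base ↔ a⁻¹ * b ∈ G.fundamentalGroup := by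
  rw [mem_fundamentalGroup, mul_smul, inv_smul_eq_iff, eq_comm]

/-- Compatibility with `next` handles `L`. For `S`, surjectivity on links is essential: if the
images of `e` and `S • e` coincide, their `∘`-vertex must be terminal, so that `S` fixes the image
edge. -/
theorem CoveringMap.map_smul (f : CoveringMap G H) (W : Modular) (e : G.Edge) :
    f.onEdge (W • e) = W • f.onEdge e := by
  induction W using induction_generators generalizing e with
  | one => rw [one_smul, one_smul]
  | hS =>
    have h := G.across_iff.2 (rfl : S • e = S • e)
    refine (H.across_iff.1 ⟨?_, fun heq d hd => ?_⟩).symm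
    · rw [f.white_comm, f.white_comm, h.1]
    · obtain ⟨e', h1, rfl⟩ := f.white_surj e d hd
      rcases G.white_eq_iff.1 h1.symm with rfl | rfl
      · rfl
      · exact heq.symm
  | hL =>
    rw [G.L_smul, H.L_smul, Equiv.eq_symm_apply, ← f.next_comm, Equiv.apply_symm_apply]
  | mul a b ha hb => rw [mul_smul, mul_smul, ha, hb]
  | inv a ha => rw [eq_inv_smul_iff, ← ha, smul_inv_smul]

theorem coveringEdge_smul_base (f : G ⟶ H) (W : Modular) :
    coveringEdge f (W • H.base) = W • G.base :=
  (CoveringMap.map_smul f W H.base).trans (congrArg (W • ·) (CoveringMap.map_base f))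

instance (G H : PointedModularGraph) : Subsingleton (G ⟶ H) where
  allEq f g := by
    have hE : coveringEdge f = coveringEdge g := by
      funext e
      obtain ⟨W, rfl⟩ := H.exists_smul_eq H.base e
      rw [coveringEdge_smul_base, coveringEdge_smul_base]
    refine CoveringMap.ext (funext fun v => ?_) (funext fun v => ?_) hE
    · obtain ⟨e, rfl⟩ := H.surjective_white v
      exact (CoveringMap.white_comm f e).symm.trans
        ((congrArg G.white (congrFun hE e)).trans (CoveringMap.white_comm g e))
    · obtain ⟨e, rfl⟩ := H.surjective_black v
      exact (CoveringMap.black_comm f e).symm.trans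
        ((congrArg G.black (congrFun hE e)).trans (CoveringMap.black_comm g e))

theorem fundamentalGroup_le (f : G ⟶ H) : H.fundamentalGroup ≤ G.fundamentalGroup := by
  intro W hW
  rw [mem_fundamentalGroup] at hW ⊢
  have hb : coveringEdge f H.base = G.base := CoveringMap.map_base f
  have h := coveringEdge_smul_base f W
  rw [hW, hb] at h
  exact h.symm

/-- Sending `W • H.base` to `W • G.base` is well defined by the inclusion of stabilizers, and an
equivariant map of edges respects the vertices, which are orbits of `⟨S⟩` and `⟨L⟩`. -/
theorem nonempty_hom (h : H.fundamentalGroup ≤ G.fundamentalGroup) : Nonempty (G ⟶ H) := by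
  choose w hw using H.exists_smul_eq H.base
  let F : H.Edge → G.Edge := fun e => w e • G.base
  have hF : ∀ W : Modular, F (W • H.base) = W • G.base := fun W =>
    smul_base_eq_iff.2 (h (smul_base_eq_iff.1 (hw (W • H.base))))
  have hFs : ∀ (W : Modular) e, F (W • e) = W • F e := by
    intro W e
    rw [← hw e, smul_smul, hF, hF, mul_smul]
  have hwhite : ∀ a b, H.white a = H.white b → G.white (F a) = G.white (F b) := by
    intro a b hab
    rcases H.white_eq_iff.1 hab with rfl | rfl
    · rfl
    · exact G.white_eq_iff.2 (Or.inr (hFs S a))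
  have hblack : ∀ a b, H.black a = H.black b → G.black (F a) = G.black (F b) := by
    intro a b hab
    obtain ⟨n, rfl⟩ := H.black_eq_iff.1 hab
    exact G.black_eq_iff.2 ⟨n, (hFs _ a).symm⟩
  refine ⟨(⟨fun v => G.white (F (Function.surjInv H.surjective_white v)),
    fun v => G.black (F (Function.surjInv H.surjective_black v)), F,
    fun e => hwhite _ _ (Function.surjInv_eq H.surjective_white _).symm,
    fun e => hblack _ _ (Function.surjInv_eq H.surjective_black _).symm, fun e => ?_,
    fun e d hd => ?_, ?_⟩ : CoveringMap H G)⟩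
  · rw [← H.L_inv_smul, hFs, G.L_inv_smul]
  · rcases G.white_eq_iff.1 hd.symm with rfl | rfl
    · exact ⟨e, rfl, rfl⟩
    · exact ⟨S • e, (H.white_eq_iff.2 (Or.inr rfl)).symm, hFs S e⟩
  · have := hF 1
    rwa [one_smul, one_smul] at this

theorem isFinite_iff : PointedModularGraph.IsFinite G ↔ G.fundamentalGroup.FiniteIndex := by
  let f : Modular ⧸ G.fundamentalGroup → G.Edge := Quotient.lift (fun a => a • G.base)
    fun a b hab => smul_base_eq_iff.2 (QuotientGroup.leftRel_apply.1 hab)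
  constructor
  · intro h
    have hfin : Finite G.Edge := h
    have hf : Function.Injective f := by
      intro a b
      induction a using Quotient.inductionOn with | h a => ?_
      induction b using Quotient.inductionOn with | h b => ?_
      exact fun hab => Quotient.sound (QuotientGroup.leftRel_apply.2 (smul_base_eq_iff.1 hab))
    have := Finite.of_injective f hf
    exact Subgroup.finiteIndex_of_finite_quotient
  · intro h
    refine Finite.of_surjective f fun e => ?_
    obtain ⟨W, rfl⟩ := G.exists_smul_eq G.base e
    exact ⟨QuotientGroup.mk W, rfl⟩

/-- The graph whose edges are the cosets of `Γ`. The edge `a⁻¹ Γ` corresponds to the image of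
`a • arc` in `Γ \ ℍ`. -/
def ofSubgroup (Γ : Subgroup Modular) : PointedModularGraph where
  White := MulAction.orbitRel.Quotient (Subgroup.zpowers S) (Modular ⧸ Γ)
  Black := MulAction.orbitRel.Quotient (Subgroup.zpowers L) (Modular ⧸ Γ)
  Edge := Modular ⧸ Γ
  white := Quotient.mk _
  black := Quotient.mk _
  white_degree v := by
    induction v using Quotient.inductionOn with | h e => ?_
    have : Quotient.mk (MulAction.orbitRel (Subgroup.zpowers S) (Modular ⧸ Γ)) ⁻¹'
        {Quotient.mk _ e} = MulAction.orbit (Subgroup.zpowers S) e := by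
      ext d
      rw [Set.mem_preimage, Set.mem_singleton_iff, Quotient.eq, MulAction.orbitRel_apply]
    rw [this]
    exact ncard_orbit_zpowers_eq Nat.prime_two S_sq e
  black_degree v := by
    induction v using Quotient.inductionOn with | h e => ?_
    have : Quotient.mk (MulAction.orbitRel (Subgroup.zpowers L) (Modular ⧸ Γ)) ⁻¹'
        {Quotient.mk _ e} = MulAction.orbit (Subgroup.zpowers L) e := by
      ext d
      rw [Set.mem_preimage, Set.mem_singleton_iff, Quotient.eq, MulAction.orbitRel_apply]
    rw [this]
    exact ncard_orbit_zpowers_eq Nat.prime_three L_cube e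
  next := MulAction.toPerm L⁻¹
  next_cyclic a b := by
    have key : ∀ n : ℤ,
        ((MulAction.toPerm L⁻¹ : Equiv.Perm (Modular ⧸ Γ)) ^ n) a = L ^ (-n) • a := by
      intro n
      change ((MulAction.toPermHom Modular (Modular ⧸ Γ) L⁻¹) ^ n) a = _
      rw [← map_zpow, inv_zpow']
      rfl
    rw [eq_comm, Quotient.eq, MulAction.orbitRel_apply]
    refine mem_orbit_zpowers_iff.trans ⟨?_, ?_⟩
    · rintro ⟨n, hn⟩
      exact ⟨-n, (key (-n)).trans (by rwa [neg_neg])⟩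
    · rintro ⟨n, hn⟩
      exact ⟨-n, (key n).symm.trans hn⟩
  connected := by
    have hsymm : Std.Symm fun a b : Modular ⧸ Γ =>
        (Quotient.mk (MulAction.orbitRel (Subgroup.zpowers S) (Modular ⧸ Γ)) a = Quotient.mk _ b ∨
          Quotient.mk (MulAction.orbitRel (Subgroup.zpowers L) (Modular ⧸ Γ)) a =
            Quotient.mk _ b) := ⟨fun a b h => h.imp Eq.symm Eq.symm⟩
    intro a b
    obtain ⟨W, rfl⟩ := MulAction.exists_smul_eq Modular a b
    induction W using induction_generators generalizing a with
    | one => rw [one_smul]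
    | hS =>
      refine Relation.ReflTransGen.single (Or.inl (Quotient.sound ?_).symm)
      exact MulAction.orbitRel_apply.2 ⟨⟨S, Subgroup.mem_zpowers S⟩, rfl⟩
    | hL =>
      refine Relation.ReflTransGen.single (Or.inr (Quotient.sound ?_).symm)
      exact MulAction.orbitRel_apply.2 ⟨⟨L, Subgroup.mem_zpowers L⟩, rfl⟩
    | mul x y hx hy =>
      rw [mul_smul]
      exact (hy a).trans (hx _)
    | inv x hx =>
      have := Std.Symm.symm (r := Relation.ReflTransGen _) _ _ (hx (x⁻¹ • a))
      rwa [smul_inv_smul] at this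
  base := QuotientGroup.mk 1

variable (Γ : Subgroup Modular)

/-- The edge `a Γ` of the graph of cosets. -/
def coset (a : Modular) : (ofSubgroup Γ).Edge := QuotientGroup.mk (s := Γ) a

theorem coset_eq_iff {a b : Modular} : coset Γ a = coset Γ b ↔ a⁻¹ * b ∈ Γ := QuotientGroup.eq

theorem base_ofSubgroup : (ofSubgroup Γ).base = coset Γ 1 := rfl

theorem white_coset_S_mul (a : Modular) :
    (ofSubgroup Γ).white (coset Γ (S * a)) = (ofSubgroup Γ).white (coset Γ a) :=
  Quotient.sound (s := MulAction.orbitRel (Subgroup.zpowers S) (Modular ⧸ Γ))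
    (MulAction.orbitRel_apply.2 ⟨⟨S, Subgroup.mem_zpowers S⟩, rfl⟩)

theorem across_coset (a : Modular) : (ofSubgroup Γ).Across (coset Γ a) (coset Γ (S * a)) := by
  refine ⟨(white_coset_S_mul Γ a).symm, fun h d hd => ?_⟩
  obtain ⟨n, hn⟩ := mem_orbit_zpowers_iff.1 (MulAction.orbitRel_apply.1
    (Quotient.exact (s := MulAction.orbitRel (Subgroup.zpowers S) (Modular ⧸ Γ)) hd))
  rcases eq_of_mem_zpowers_S ⟨n, rfl⟩ with h1 | h1
  · have : coset Γ (1 * a) = d := h1 ▸ hn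
    rw [← this, one_mul]
  · have : coset Γ (S * a) = d := h1 ▸ hn
    rw [← this, ← h]

theorem next_coset (a : Modular) : (ofSubgroup Γ).next (coset Γ a) = coset Γ (L⁻¹ * a) := rfl

/-- The action obtained from the graph structure is left multiplication on cosets, since the two
agree on the generators. -/
theorem smul_coset (W a : Modular) : W • coset Γ a = coset Γ (W * a) := by
  induction W using induction_generators generalizing a with
  | one => rw [one_smul, one_mul]
  | hS => exact (ofSubgroup Γ).across_iff.1 (across_coset Γ a)
  | hL => rw [ModularGraph.L_smul, Equiv.symm_apply_eq, next_coset, inv_mul_cancel_left]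
  | mul x y hx hy => rw [mul_smul, hy, hx, mul_assoc]
  | inv x hx => rw [inv_smul_eq_iff, hx, mul_inv_cancel_left]

theorem fundamentalGroup_ofSubgroup : (ofSubgroup Γ).fundamentalGroup = Γ := by
  ext W
  rw [mem_fundamentalGroup, base_ofSubgroup, smul_coset, eq_comm, coset_eq_iff, inv_one, one_mul,
    mul_one]

/-- The fundamental group functor. -/
def fundamentalGroupFunctor : PointedModularGraphᵒᵖ ⥤ Sub where
  obj G := G.unop.fundamentalGroup
  map f := homOfLE (fundamentalGroup_le f.unop)

instance : fundamentalGroupFunctor.Faithful where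
  map_injective _ := Quiver.Hom.unop_inj (Subsingleton.elim _ _)

instance : fundamentalGroupFunctor.Full where
  map_surjective f := ⟨(nonempty_hom (leOfHom f)).some.op, Subsingleton.elim _ _⟩

instance : fundamentalGroupFunctor.EssSurj where
  mem_essImage Γ := ⟨Opposite.op (ofSubgroup Γ), ⟨eqToIso (fundamentalGroup_ofSubgroup Γ)⟩⟩

instance : fundamentalGroupFunctor.IsEquivalence where

end PointedModularGraph

/-! ## The graph on a cover -/

namespace PointedCover

variable (X : PointedCover)

/-- The graph of cosets of the fundamental group. -/
abbrev graph : PointedModularGraph := PointedModularGraph.ofSubgroup X.fundamentalGroup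

/-- The edge of the graph which corresponds to the image of `a⁻¹ • arc`. -/
abbrev edge (a : Modular) : X.graph.Edge := PointedModularGraph.coset X.fundamentalGroup a

theorem exists_edge_eq (e : X.graph.Edge) : ∃ a, X.edge a = e := Quotient.mk_surjective e

variable {X} in
theorem univ_inv_smul_of_edge_eq {a b : Modular} (h : X.edge a = X.edge b) (z : ℍ) :
    X.univ (a⁻¹ • z) = X.univ (b⁻¹ • z) := by
  rw [PointedModularGraph.coset_eq_iff] at h
  exact univ_eq_iff.2 ⟨(a⁻¹ * b)⁻¹, inv_mem h, by rw [smul_smul]; congr 1; group⟩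

/-- The arc in `X` which corresponds to an edge of the graph. -/
def edgePath (e : X.graph.Edge) (t : I) : X.carrier :=
  X.univ ((X.exists_edge_eq e).choose⁻¹ • arc t)

theorem edgePath_edge (a : Modular) (t : I) : X.edgePath (X.edge a) t = X.univ (a⁻¹ • arc t) :=
  univ_inv_smul_of_edge_eq (X.exists_edge_eq (X.edge a)).choose_spec _

theorem continuous_edgePath (e : X.graph.Edge) : Continuous (X.edgePath e) :=
  X.continuous_univ.comp (continuous_arc.const_smul (X.exists_edge_eq e).choose⁻¹)

theorem proj_edgePath (e : X.graph.Edge) (t : I) : X.proj (X.edgePath e t) = toOrb (arc t) := by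
  rw [edgePath, proj_univ, toOrb_smul]

theorem smul_edge (W a : Modular) : W • X.edge a = X.edge (W * a) :=
  PointedModularGraph.smul_coset _ W a

theorem edgePath_smul {W : Modular} {t : I} (h : W • arc t = arc t) (e : X.graph.Edge) :
    X.edgePath (W • e) t = X.edgePath e t := by
  obtain ⟨a, rfl⟩ := X.exists_edge_eq e
  rw [smul_edge, edgePath_edge, edgePath_edge, mul_inv_rev, mul_smul, inv_smul_eq_iff.2 h.symm]

/-- An identification in `X` comes from a group element carrying a point of the arc to a point of
the arc; its possible values `1`, `S`, `L`, `L ^ 2` are the cases of the gluing relation. -/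
theorem edgePath_eq_iff (e d : X.graph.Edge) (s t : I) :
    X.edgePath e s = X.edgePath d t ↔ X.graph.gluing ⟨e, s⟩ ⟨d, t⟩ := by
  constructor
  · intro h
    obtain ⟨a, rfl⟩ := X.exists_edge_eq e
    obtain ⟨b, rfl⟩ := X.exists_edge_eq d
    rw [edgePath_edge, edgePath_edge, univ_eq_iff] at h
    obtain ⟨γ, hγ, h⟩ := h
    rw [eq_inv_smul_iff, smul_smul, smul_smul] at h
    have key : ∀ W : Modular, b * γ * a⁻¹ = W → W • X.edge a = X.edge b := by
      rintro _ rfl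
      rw [smul_edge, inv_mul_cancel_right, PointedModularGraph.coset_eq_iff]
      simpa using inv_mem hγ
    obtain ⟨rfl, hW | ⟨rfl, hW⟩ | ⟨rfl, hW⟩⟩ := eq_of_smul_arc_eq h
    · have := key _ hW
      rw [one_smul] at this
      exact Or.inl (by rw [this])
    · exact Or.inr (Or.inl ⟨rfl, rfl, X.graph.white_eq_iff.2 (Or.inr (key _ hW).symm)⟩)
    · refine Or.inr (Or.inr ⟨rfl, rfl, X.graph.black_eq_iff.2 ?_⟩)
      rcases hW with hW | hW
      · exact ⟨1, by rw [zpow_one]; exact key _ hW⟩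
      · exact ⟨2, key _ hW⟩
  · rintro (h | ⟨h1, h2, h3⟩ | ⟨h1, h2, h3⟩)
    · cases h
      rfl
    · dsimp only at h1 h2 h3
      subst h1 h2
      rcases X.graph.white_eq_iff.1 h3 with rfl | rfl
      · rfl
      · exact (X.edgePath_smul S_smul_arc_zero e).symm
    · dsimp only at h1 h2 h3
      subst h1 h2
      obtain ⟨n, rfl⟩ := X.graph.black_eq_iff.1 h3
      have hL : L ∈ MulAction.stabilizer Modular (arc 1) := L_smul_arc_one
      exact (X.edgePath_smul (zpow_mem hL n) e).symm

theorem edgePath_mem_spine (e : X.graph.Edge) (t : I) : X.edgePath e t ∈ X.spine :=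
  ⟨t, (X.proj_edgePath e t).symm⟩

/-- The map from the realization of the graph to the cover. -/
def realize : X.graph.Realization → X.spine :=
  Quotient.lift (fun x => ⟨X.edgePath x.1 x.2, X.edgePath_mem_spine x.1 x.2⟩) fun x y h =>
    Subtype.ext ((X.edgePath_eq_iff x.1 y.1 x.2 y.2).2 h)

theorem realize_point (e : X.graph.Edge) (t : I) :
    (X.realize (X.graph.point e t) : X.carrier) = X.edgePath e t := rfl

theorem realize_bijective : Function.Bijective X.realize := by
  constructor
  · intro x y
    induction x using Quotient.inductionOn with | h x => ?_
    induction y using Quotient.inductionOn with | h y => ?_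
    intro h
    exact Quotient.sound ((X.edgePath_eq_iff x.1 y.1 x.2 y.2).1 (congrArg Subtype.val h))
  · rintro ⟨x, t, hx⟩
    obtain ⟨z, rfl⟩ := X.surjective_univ x
    obtain ⟨γ, rfl⟩ := toOrb_eq_iff.1 ((X.proj_univ z).symm.trans hx.symm)
    refine ⟨X.graph.point (X.edge γ⁻¹) t, Subtype.ext ?_⟩
    rw [realize_point, edgePath_edge, inv_inv]

theorem continuous_realize : Continuous X.realize :=
  Continuous.quotient_lift (continuous_sigma fun e =>
    (X.continuous_edgePath e).subtype_mk (X.edgePath_mem_spine e)) _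

/-- Pulled back to `ℍ`, the image of a closed set is a union of compact pieces of translates of the
arc. The family is locally finite because the arc lies in the fundamental domain. -/
theorem isClosedMap_realize : IsClosedMap X.realize := by
  intro C hC
  have hpoint : ∀ e, IsClosed {t | X.graph.point e t ∈ C} := fun e =>
    hC.preimage (continuous_quotient_mk'.comp continuous_sigmaMk)
  have heq : X.univ ⁻¹' (Subtype.val '' (X.realize '' C)) =
      ⋃ γ : Modular, (γ • ·) '' (arc '' {t | X.graph.point (X.edge γ⁻¹) t ∈ C}) := by
    ext z
    constructor
    · rintro ⟨_, ⟨x, hx, rfl⟩, hz⟩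
      induction x using Quotient.inductionOn with | h x => ?_
      obtain ⟨e, t⟩ := x
      obtain ⟨a, rfl⟩ := X.exists_edge_eq e
      have h1 : X.univ (a⁻¹ • arc t) = X.univ z := (X.edgePath_edge a t).symm.trans hz
      obtain ⟨γ, hγ, rfl⟩ := univ_eq_iff.1 h1
      have h2 : X.edge (γ * a⁻¹)⁻¹ = X.edge a := by
        rw [PointedModularGraph.coset_eq_iff]
        simpa using hγ
      refine Set.mem_iUnion.2 ⟨γ * a⁻¹, arc t, ⟨t, ?_, rfl⟩, mul_smul _ _ _⟩
      rw [h2]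
      exact hx
    · intro hz
      obtain ⟨γ, _, ⟨t, ht, rfl⟩, rfl⟩ := Set.mem_iUnion.1 hz
      refine ⟨_, ⟨_, ht, rfl⟩, ?_⟩
      rw [realize_point, edgePath_edge, inv_inv]
  have hclosed : IsClosed (Subtype.val '' (X.realize '' C)) := by
    rw [← X.isOpenQuotientMap_univ.isQuotientMap.isClosed_preimage, heq]
    refine LocallyFinite.isClosed_iUnion (locallyFinite_smul_fd.subset ?_) fun γ => ?_
    · rintro γ _ ⟨_, ⟨t, -, rfl⟩, rfl⟩
      change γ⁻¹ • γ • arc t ∈ ModularGroup.fd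
      rw [inv_smul_smul]
      exact arc_mem_fd t
    · exact (((hpoint _).isCompact.image continuous_arc).image (continuous_const_smul γ)).isClosed
  rw [← Set.preimage_image_eq (X.realize '' C) Subtype.val_injective]
  exact hclosed.preimage continuous_subtype_val

/-- The homeomorphism from the realization of the graph to the preimage of the modular arc. -/
def realizeHomeo : X.graph.Realization ≃ₜ X.spine :=
  (Equiv.ofBijective X.realize X.realize_bijective).toHomeomorphOfContinuousClosed
    X.continuous_realize X.isClosedMap_realize

theorem realizeHomeo_point (e : X.graph.Edge) (t : I) :
    (X.realizeHomeo (X.graph.point e t) : X.carrier) = X.edgePath e t := rfl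

theorem edgePath_base (t : I) : X.edgePath X.graph.base t = X.univ (arc t) :=
  (X.edgePath_edge 1 t).trans (by rw [inv_one, one_smul])

/-- The identification of the graph of cosets with the graph on the cover. -/
def spineIso : SpineIso X.graph X where
  homeo := X.realizeHomeo
  proj_homeo e t := X.proj_edgePath e t
  homeo_base := (X.edgePath_base half).trans X.univ_basePt
  homeo_next q hq e h t := by
    obtain ⟨γ, hγ⟩ := exists_smul_of_isLift hq
    obtain ⟨a, rfl⟩ := X.exists_edge_eq e
    -- The base point is free, so equality there determines `γ` modulo the fundamental group.
    have h1 : X.univ (γ • basePt) = X.univ (a⁻¹ • basePt) := by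
      rw [← hγ]
      exact (h half).trans (X.edgePath_edge a half)
    rw [univ_eq_iff_of_mem_free basePt_mem_free] at h1
    have h2 : X.edge (L⁻¹ * γ⁻¹) = X.edge (L⁻¹ * a) := by
      rw [PointedModularGraph.coset_eq_iff]
      convert inv_mem h1 using 1
      group
    rw [hγ, realizeHomeo_point, PointedModularGraph.next_coset, edgePath_edge,
      ← univ_inv_smul_of_edge_eq h2, mul_inv_rev, inv_inv, inv_inv, mul_smul]

/-- The functor which takes a cover to its graph. -/
def graphFunctor : PointedCover ⥤ PointedModularGraph where
  obj X := X.graph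
  map f := (PointedModularGraph.nonempty_hom (by
    rw [PointedModularGraph.fundamentalGroup_ofSubgroup,
      PointedModularGraph.fundamentalGroup_ofSubgroup]
    exact fundamentalGroup_le f)).some
  map_id _ := Subsingleton.elim _ _
  map_comp _ _ := Subsingleton.elim _ _

variable {X}

theorem coveringEdge_graphFunctor {X Y : PointedCover} (f : X ⟶ Y) (a : Modular) :
    PointedModularGraph.coveringEdge (graphFunctor.map f) (Y.edge a) = X.edge a := by
  have h : ∀ Z : PointedCover, Z.edge a = a • Z.graph.base := fun Z => by
    rw [PointedModularGraph.base_ofSubgroup, PointedModularGraph.smul_coset, mul_one]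
  rw [h, h]
  exact PointedModularGraph.coveringEdge_smul_base (graphFunctor.map f) a

theorem covering_edgePath {X Y : PointedCover} (f : X ⟶ Y) (e : Y.graph.Edge) (t : I) :
    covering f (Y.edgePath e t) =
      X.edgePath (PointedModularGraph.coveringEdge (graphFunctor.map f) e) t := by
  obtain ⟨a, rfl⟩ := Y.exists_edge_eq e
  exact (congrArg (covering f) (Y.edgePath_edge a t)).trans ((covering_univ f _).trans
    ((X.edgePath_edge a t).symm.trans
      (congrArg (X.edgePath · t) (coveringEdge_graphFunctor f a).symm)))

theorem fundamentalGroup_graph (X : PointedCover) :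
    (graphFunctor.obj X).fundamentalGroup = X.fundamentalGroup :=
  PointedModularGraph.fundamentalGroup_ofSubgroup _

theorem nonempty_iso_graph (X : PointedCover) {G : PointedModularGraph}
    (h : X.fundamentalGroup = G.fundamentalGroup) : Nonempty (graphFunctor.obj X ≅ G) := by
  rw [← fundamentalGroup_graph] at h
  obtain ⟨f⟩ := PointedModularGraph.nonempty_hom h.ge
  obtain ⟨g⟩ := PointedModularGraph.nonempty_hom h.le
  exact ⟨⟨f, g, Subsingleton.elim _ _, Subsingleton.elim _ _⟩⟩

instance : graphFunctor.Faithful where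
  map_injective _ := Subsingleton.elim _ _

instance : graphFunctor.Full where
  map_surjective {X Y} f := by
    have h := PointedModularGraph.fundamentalGroup_le f
    rw [fundamentalGroup_graph, fundamentalGroup_graph] at h
    exact ⟨(nonempty_hom h).some, Subsingleton.elim _ _⟩

instance : graphFunctor.EssSurj where
  mem_essImage _ := ⟨_, nonempty_iso_graph _ (fundamentalGroup_ofSubgroup _)⟩

instance : graphFunctor.IsEquivalence where

/-! ## The deformation retractions of covers -/

/-- The deformation retraction of a cover onto its graph. -/
def homotopy (X : PointedCover) (x : I × X.carrier) : X.carrier :=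
  X.univ (retraction (x.1, Function.surjInv X.surjective_univ x.2))

/-- Equivariance of the retraction makes the result independent of the chosen preimage in `ℍ`. -/
theorem homotopy_univ (X : PointedCover) (t : I) (z : ℍ) :
    X.homotopy (t, X.univ z) = X.univ (retraction (t, z)) := by
  obtain ⟨γ, hγ, h⟩ := univ_eq_iff.1 (Function.surjInv_eq X.surjective_univ (X.univ z))
  refine univ_eq_iff.2 ⟨γ, hγ, ?_⟩
  rw [← retraction_smul]
  exact congrArg (fun w => retraction (t, w)) h

theorem univ_mem_spine_iff (X : PointedCover) {z : ℍ} : X.univ z ∈ X.spine ↔ z ∈ fareyTree := by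
  constructor
  · rintro ⟨t, ht⟩
    rw [proj_univ] at ht
    obtain ⟨γ, h⟩ := toOrb_eq_iff.1 ht.symm
    exact ⟨γ, t, h.symm⟩
  · rintro ⟨γ, t, rfl⟩
    exact ⟨t, by rw [proj_univ, toOrb_smul]⟩

theorem isDeformationRetraction_homotopy (X : PointedCover) :
    IsDeformationRetraction X.homotopy X.spine where
  continuous := by
    -- Openness of the universal map keeps the product with `I` a quotient map, through which
    -- continuity descends.
    have h := (IsOpenQuotientMap.id (X := I)).prodMap X.isOpenQuotientMap_univ
    rw [h.isQuotientMap.continuous_iff]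
    exact (X.continuous_univ.comp continuous_retraction).congr fun x =>
      (X.homotopy_univ x.1 x.2).symm
  start x := by
    obtain ⟨z, rfl⟩ := X.surjective_univ x
    rw [homotopy_univ, isDeformationRetraction_retraction.start]
  finish x := by
    obtain ⟨z, rfl⟩ := X.surjective_univ x
    rw [homotopy_univ, univ_mem_spine_iff]
    exact isDeformationRetraction_retraction.finish z
  fixed t x hx := by
    obtain ⟨z, rfl⟩ := X.surjective_univ x
    rw [univ_mem_spine_iff] at hx
    rw [homotopy_univ, isDeformationRetraction_retraction.fixed t z hx]

theorem IsLift.map_retraction {X : PointedCover} {q : ℍ → X.carrier} (hq : X.IsLift q) (t : I)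
    (z : ℍ) : q (retraction (t, z)) = X.homotopy (t, q z) := by
  obtain ⟨γ, hγ⟩ := exists_smul_of_isLift hq
  rw [hγ, hγ, homotopy_univ, retraction_smul]

theorem covering_homotopy {X Y : PointedCover} (f : X ⟶ Y) (t : I) (y : Y.carrier) :
    covering f (Y.homotopy (t, y)) = X.homotopy (t, covering f y) := by
  obtain ⟨z, rfl⟩ := Y.surjective_univ y
  rw [homotopy_univ, covering_univ, covering_univ, homotopy_univ]

end PointedCover

/-! ## The functors on finite covers, finite graphs and subgroups of finite index -/

/-- The functor which takes a finite cover to its graph. -/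
def finiteGraphFunctor : FinitePointedCover ⥤ FinitePointedModularGraph :=
  PointedModularGraph.IsFinite.lift (PointedCover.IsFinite.ι ⋙ PointedCover.graphFunctor) fun X =>
    PointedModularGraph.isFinite_iff.2 (by
      rw [Functor.comp_obj, PointedCover.fundamentalGroup_graph]
      exact PointedCover.isFinite_iff.1 X.property)

/-- The fundamental group functor on finite covers. -/
def finiteCoverGroupFunctor : FinitePointedCoverᵒᵖ ⥤ FSub :=
  HasFiniteIndex.lift (PointedCover.IsFinite.ι.op ⋙ PointedCover.fundamentalGroupFunctor)
    fun X => by exact PointedCover.isFinite_iff.1 X.unop.property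

/-- The fundamental group functor on finite graphs. -/
def finiteGraphGroupFunctor : FinitePointedModularGraphᵒᵖ ⥤ FSub :=
  HasFiniteIndex.lift (PointedModularGraph.IsFinite.ι.op ⋙
    PointedModularGraph.fundamentalGroupFunctor)
    fun X => by exact PointedModularGraph.isFinite_iff.1 X.unop.property

instance : finiteGraphFunctor.EssSurj where
  mem_essImage G := by
    have hπ := PointedCover.fundamentalGroup_ofSubgroup G.obj.fundamentalGroup
    have hX : PointedCover.IsFinite (PointedCover.ofSubgroup G.obj.fundamentalGroup) := by
      rw [PointedCover.isFinite_iff, hπ]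
      exact PointedModularGraph.isFinite_iff.1 G.property
    obtain ⟨i⟩ := PointedCover.nonempty_iso_graph _ hπ
    exact ⟨⟨_, hX⟩, ⟨PointedModularGraph.IsFinite.ι.preimageIso i⟩⟩

instance : finiteCoverGroupFunctor.EssSurj where
  mem_essImage Γ := by
    have hπ := PointedCover.fundamentalGroup_ofSubgroup Γ.obj
    have hX : PointedCover.IsFinite (PointedCover.ofSubgroup Γ.obj) := by
      rw [PointedCover.isFinite_iff, hπ]
      exact Γ.property
    exact ⟨Opposite.op ⟨_, hX⟩, ⟨HasFiniteIndex.ι.preimageIso (eqToIso hπ)⟩⟩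

instance : finiteGraphGroupFunctor.EssSurj where
  mem_essImage Γ := by
    have hπ := PointedModularGraph.fundamentalGroup_ofSubgroup Γ.obj
    have hX : PointedModularGraph.IsFinite (PointedModularGraph.ofSubgroup Γ.obj) := by
      rw [PointedModularGraph.isFinite_iff, hπ]
      exact Γ.property
    exact ⟨Opposite.op ⟨_, hX⟩, ⟨HasFiniteIndex.ι.preimageIso (eqToIso hπ)⟩⟩

instance : finiteGraphFunctor.IsEquivalence where
  faithful := inferInstanceAs (PointedModularGraph.IsFinite.lift _ _).Faithful
  full := inferInstanceAs (PointedModularGraph.IsFinite.lift _ _).Full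

instance : finiteCoverGroupFunctor.IsEquivalence where
  faithful := Functor.Faithful.of_comp_iso (HasFiniteIndex.liftCompιIso
    (PointedCover.IsFinite.ι.op ⋙ PointedCover.fundamentalGroupFunctor) _)
  full := Functor.Full.of_comp_faithful_iso (HasFiniteIndex.liftCompιIso
    (PointedCover.IsFinite.ι.op ⋙ PointedCover.fundamentalGroupFunctor) _)

instance : finiteGraphGroupFunctor.IsEquivalence where
  faithful := Functor.Faithful.of_comp_iso (HasFiniteIndex.liftCompιIso
    (PointedModularGraph.IsFinite.ι.op ⋙ PointedModularGraph.fundamentalGroupFunctor) _)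
  full := Functor.Full.of_comp_faithful_iso (HasFiniteIndex.liftCompιIso
    (PointedModularGraph.IsFinite.ι.op ⋙ PointedModularGraph.fundamentalGroupFunctor) _)

end ModularOrbifold

end

/-! ### Assembly of the theorem. -/

open ModularOrbifold in
theorem mainTheorem1 :
    -- `ℍ` is the universal orbifold cover of the modular orbifold, with deck group `PSL(2, ℤ)`
    (IsOrbifoldCover toOrb ∧
      (∀ X : PointedCover, ∃! q : ℍ → X.carrier, X.IsLift q ∧ q basePt = X.base) ∧
      (∀ φ : ℍ → ℍ, Continuous φ → (∀ z, toOrb (φ z) = toOrb z) →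
        ∃! γ : Modular, ∀ z, φ z = γ • z)) ∧
    ∃ (R : I × ℍ → ℍ) (H : ∀ X : PointedCover, I × X.carrier → X.carrier)
      (D : PointedCover ⥤ PointedModularGraph) (h : ∀ X : PointedCover, SpineIso (D.obj X) X)
      (P : PointedCoverᵒᵖ ⥤ Sub) (Q : PointedModularGraphᵒᵖ ⥤ Sub)
      (D' : FinitePointedCover ⥤ FinitePointedModularGraph)
      (P' : FinitePointedCoverᵒᵖ ⥤ FSub) (Q' : FinitePointedModularGraphᵒᵖ ⥤ FSub),
      -- an equivariant deformation retraction of `ℍ` onto the Farey tree, which descends to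
      -- deformation retractions of all covers onto their graphs, naturally in the cover
      IsDeformationRetraction R fareyTree ∧
      (∀ (γ : Modular) t z, R (t, γ • z) = γ • R (t, z)) ∧
      (∀ X, IsDeformationRetraction (H X) X.spine) ∧
      (∀ X (q : ℍ → X.carrier), X.IsLift q → ∀ t z, q (R (t, z)) = H X (t, q z)) ∧
      (∀ (X Y : PointedCover) (f : X ⟶ Y) t y,
        PointedCover.covering f (H Y (t, y)) = H X (t, PointedCover.covering f y)) ∧
      -- `D` takes a cover to the graph onto which it retracts, and restricts to `D'`
      (∀ (X Y : PointedCover) (f : X ⟶ Y) e t,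
        PointedCover.covering f ((h Y).homeo ((D.obj Y).point e t)) =
          (h X).homeo ((D.obj X).point (PointedModularGraph.coveringEdge (D.map f) e) t)) ∧
      Nonempty (D' ⋙ PointedModularGraph.IsFinite.ι ≅ PointedCover.IsFinite.ι ⋙ D) ∧
      -- `P`, `Q` and `P'`, `Q'` are the fundamental group functors, and `D` preserves
      -- fundamental groups
      (∀ X, P.obj X = X.unop.fundamentalGroup) ∧
      (∀ G, Q.obj G = G.unop.fundamentalGroup) ∧
      (∀ X, (P'.obj X).obj = X.unop.obj.fundamentalGroup) ∧
      (∀ G, (Q'.obj G).obj = G.unop.obj.fundamentalGroup) ∧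
      (∀ X, (D.obj X).fundamentalGroup = X.fundamentalGroup) ∧
      -- the equivalences for finite covers and finite index subgroups
      D'.IsEquivalence ∧ P'.IsEquivalence ∧ Q'.IsEquivalence ∧
      -- the equivalences for all covers and all subgroups
      D.IsEquivalence ∧ P.IsEquivalence ∧ Q.IsEquivalence := by
  refine ⟨⟨isOrbifoldCover_toOrb, PointedCover.existsUnique_lift, existsUnique_smul⟩,
    retraction, PointedCover.homotopy, PointedCover.graphFunctor, PointedCover.spineIso,
    PointedCover.fundamentalGroupFunctor, PointedModularGraph.fundamentalGroupFunctor,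
    finiteGraphFunctor, finiteCoverGroupFunctor, finiteGraphGroupFunctor,
    isDeformationRetraction_retraction, retraction_smul,
    PointedCover.isDeformationRetraction_homotopy,
    fun _ _ hq => hq.map_retraction, fun _ _ => PointedCover.covering_homotopy,
    -- The finite functor is a lift of the restricted one, so the two composites agree by
    -- definition.
    fun _ _ f e t => PointedCover.covering_edgePath f e t, ⟨Iso.refl _⟩,
    fun _ => rfl, fun _ => rfl, fun _ => rfl, fun _ => rfl, PointedCover.fundamentalGroup_graph,
    inferInstance, inferInstance, inferInstance, inferInstance, inferInstance, inferInstance⟩
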